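/- Let $K$ be a zero-dimensional compact line, that is, a linearly ordered set that is compact in its order topology and whose clopen subsets form a base of that topology. Let $L$ be the set of all left- or right-isolated points of $K$, i.e. $$L=\{x\in K : \exists\, y\in K\setminus\{x\},\ [\min(x,y),\max(x,y)]=\{x,y\}\}.$$ A metric $d$ on the set $K$ (its topology need not be that of $K$) is said to fragment $K$ if for every nonempty $Y\subset K$ and every $\varepsilon>0$ there is a nonempty relatively open $V\subset Y$ with $\sup\{d(x,y):x,y\in V\}<\varepsilon$. Let $[K]^\omega$ be the family of all countable (finite or countably infinite) subsets of $K$. A family $\Delta\subset[K]^\omega$ is a club if it is closed under unions of increasing sequences $M_1\subset M_2\subset\cdots$ of its elements and every $M\in[K]^\omega$ is contained in some $N\in\Delta$; a subfamily of $[K]^\omega$ is stationary if it meets every club. A set $M\subset K$ captures $x\in K$ if there is $z\in M$ such that only finitely many elements of $M\cap L$ lie between $x$ and $z$. A linear order is scattered if it contains no copy of the linear order $\mathbb{Q}$, and $\sigma$-scattered if it is a countable union of scattered suborders. Then the following four conditions are equivalent: (i) $K$ is fragmentable, i.e. some metric on $K$ fragments $K$; (ii) the family $\Gamma=\{M\in[K]^\omega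 : \text{there is } x\in L \text{ not captured by } M\}$ is non-stationary in $[K]^\omega$; (iii) $L$, with the order inherited from $K$, is $\sigma$-scattered; (iv) $K$ is Radon–Nikodým compact, i.e. $K$ is fragmented by some metric $d$ that is lower semicontinuous, meaning that $\{(x,y)\in K\times K : d(x,y)\le r\}$ is closed for every $r>0$. -/

import Mathlib

open Set

universe u

namespace CompactLine

/-! ### Fragmentability -/

/-- A real-valued function of two variables is a metric on the set `X`. No relation with a topology
on `X` is required. -/
structure IsMetric {X : Type u} (d : X → X → ℝ) : Prop where
  nonneg : ∀ x y, 0 ≤ d x y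
  eq_zero_iff : ∀ x y, d x y = 0 ↔ x = y
  symm : ∀ x y, d x y = d y x
  triangle : ∀ x y z, d x z ≤ d x y + d y z

/-- `d` fragments `X`: every nonempty `Y ⊆ X` has, for every `ε > 0`, a nonempty relatively open
subset `U ∩ Y` with `sup {d x y | x, y ∈ U ∩ Y} < ε`. (The supremum is smaller than `ε` exactly
when some `δ < ε` is an upper bound.) -/
def Fragments {X : Type u} [TopologicalSpace X] (d : X → X → ℝ) : Prop :=
  ∀ Y : Set X, Y.Nonempty → ∀ ε : ℝ, 0 < ε →
    ∃ U : Set X, IsOpen U ∧ (U ∩ Y).Nonempty ∧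
      ∃ δ : ℝ, δ < ε ∧ ∀ x ∈ U ∩ Y, ∀ y ∈ U ∩ Y, d x y ≤ δ

/-- Some metric fragments `X`. -/
def IsFragmentable (X : Type u) [TopologicalSpace X] : Prop :=
  ∃ d : X → X → ℝ, IsMetric d ∧ Fragments d

/-- The Radon–Nikodým property of a compact space: some metric that is lower semicontinuous on
`X × X` fragments `X`. -/
def IsRadonNikodymCompact (X : Type u) [TopologicalSpace X] : Prop :=
  ∃ d : X → X → ℝ, IsMetric d ∧ LowerSemicontinuous (fun p : X × X => d p.1 p.2) ∧ Fragments d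

/-! ### Zero-dimensional spaces -/

/-- The clopen sets form a base of the topology. -/
def IsZeroDimensional (X : Type u) [TopologicalSpace X] : Prop :=
  TopologicalSpace.IsTopologicalBasis {s : Set X | IsClopen s}

/-! ### Stationary families of countable sets -/

/-- The family `[X]^ω` of all countable (possibly finite) subsets of `X`. -/
def countableSubsets (X : Type u) : Set (Set X) :=
  {M | M.Countable}

/-- `Δ` is a club in `[X]^ω`. -/
structure IsClubFamily {X : Type u} (Δ : Set (Set X)) : Prop where
  subset : Δ ⊆ countableSubsets X
  closed : ∀ M : ℕ → Set X, Monotone M → (∀ n, M n ∈ Δ) → (⋃ n, M n) ∈ Δ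
  unbounded : ∀ M ∈ countableSubsets X, ∃ N ∈ Δ, M ⊆ N

/-- `S` is stationary in `[X]^ω`: it meets every club. -/
def IsStationaryFamily {X : Type u} (S : Set (Set X)) : Prop :=
  ∀ Δ : Set (Set X), IsClubFamily Δ → (S ∩ Δ).Nonempty

/-! ### Scattered orders -/

/-- The linear order `Z` contains no copy of the order of the rationals. -/
def IsScatteredOrder (Z : Type u) [LinearOrder Z] : Prop :=
  IsEmpty (ℚ ↪o Z)

/-- `Z` is a union of countably many scattered suborders. -/
def IsSigmaScattered (Z : Type u) [LinearOrder Z] : Prop :=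
  ∃ S : ℕ → Set Z, (⋃ n, S n) = univ ∧ ∀ n, IsScatteredOrder (S n)

/-! ### One-sided isolated points and capturing -/

/-- The set `L` of the left-isolated or right-isolated elements: those `x` which have an immediate
predecessor or an immediate successor `y`. Here `uIcc x y = [min x y, max x y]`. -/
def isolatedPts (K : Type u) [LinearOrder K] : Set K :=
  {x | ∃ y, y ≠ x ∧ uIcc x y = {x, y}}

/-- `M` captures `x`: for some `z ∈ M` only finitely many elements of `M ∩ L` lie between
`x` and `z`. Here `uIoo x z` is the open interval with end points `x` and `z`, in either order. -/
def Captures {K : Type u} [LinearOrder K] (M : Set K) (x : K) : Prop :=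
  ∃ z ∈ M, (M ∩ isolatedPts K ∩ uIoo x z).Finite

/-- The family `Γ` of the countable `M ⊆ K` that fail to capture some point of `L`. -/
def nonCapturing (K : Type u) [LinearOrder K] : Set (Set K) :=
  {M | M ∈ countableSubsets K ∧ ∃ x ∈ isolatedPts K, ¬ Captures M x}

end CompactLine

/-! The conditions are linked through gaps. A countable set `N` has a gap `[a, b]` if it misses this
interval but accumulates at `a` from the left and at `b` from the right; `IsGapFree` says that
countable sets closed under a suitable finitary operation have no gaps.

(i) to (ii): fragmentability yields, for each `ε`, an upper semicontinuous ordinal rank whose level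
sets have diameter below `ε`. If `N` contains the extremal points of maximal rank between its
elements, both ends of a gap have the same rank, for all `ε` at once, so they coincide
(`IsFragmentable.isGapFree`). A point of `L` that a sufficiently closed `N` fails to capture
produces a gap of `N`.

(ii) to (iii): clubs contain the countable sets closed under some finitary operation, and a gap
contains a jump whose left end `N` fails to capture, so (ii) gives back gap-freeness. Then suitable
points outside a closed set have a nearest element of that set on one side. A filtration by closed
sets of smaller cardinality turns this into a rank where each element has a parent, the nearest
element of lower rank on one side. Walks along parents are finite, and colouring by their codes
makes the order `σ`-scattered (`sigmaScatteredIn_univ_of_rank`).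

(iii) to (iv): if scattered sets `S n` cover `L`, let the distance of two points be the sum of `2⁻ⁿ`
over those `n` for which a jump with left end in `S n` separates them. Jumps are clopen cuts, whence
lower semicontinuity; failure of fragmentation would grow a copy of `ℚ` in some `S n`. -/

namespace CompactLine

/-! ### Scattered and `σ`-scattered sets -/

section Scattered

variable {X Y : Type*} [LinearOrder X] [LinearOrder Y]

/-- The set `A` contains no copy of the rationals. -/
def ScatteredIn (A : Set X) : Prop :=
  ∀ g : ℚ → X, StrictMono g → ∃ q, g q ∉ A

/-- The set `A` is covered by countably many scattered sets. -/
def SigmaScatteredIn (A : Set X) : Prop :=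
  ∃ S : ℕ → Set X, A ⊆ ⋃ n, S n ∧ ∀ n, ScatteredIn (S n)

theorem isScatteredOrder_iff {Z : Type u} [LinearOrder Z] (A : Set Z) :
    IsScatteredOrder A ↔ ScatteredIn A := by
  constructor
  · intro h g hg
    by_contra! hA
    exact h.false (OrderEmbedding.ofStrictMono (fun q => (⟨g q, hA q⟩ : A)) fun _ _ h => hg h)
  · intro h
    refine ⟨fun f => ?_⟩
    obtain ⟨q, hq⟩ := h (fun q => (f q : Z)) fun _ _ h => f.strictMono h
    exact hq (f q).2

theorem isSigmaScattered_iff {Z : Type u} [LinearOrder Z] (A : Set Z) :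
    IsSigmaScattered A ↔ SigmaScatteredIn A := by
  constructor
  · rintro ⟨S, hS, hs⟩
    refine ⟨fun n => Subtype.val '' S n, fun x hx => ?_, fun n g hg => ?_⟩
    · have : (⟨x, hx⟩ : A) ∈ ⋃ n, S n := hS ▸ mem_univ _
      obtain ⟨n, hn⟩ := mem_iUnion.1 this
      exact mem_iUnion.2 ⟨n, _, hn, rfl⟩
    · by_contra! h
      choose y hy hyg using h
      obtain ⟨q, hq⟩ := (isScatteredOrder_iff _).1 (hs n) y fun a b hab => by
        have := hg hab
        rw [← hyg, ← hyg] at this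
        exact this
      exact hq (hy q)
  · rintro ⟨S, hS, hs⟩
    refine ⟨fun n => Subtype.val ⁻¹' S n, ?_, fun n => (isScatteredOrder_iff _).2 fun g hg => ?_⟩
    · rw [← preimage_iUnion, eq_univ_iff_forall]
      exact fun x => hS x.2
    · exact hs n (fun q => g q) fun _ _ h => hg h

theorem ScatteredIn.mono {A B : Set X} (h : ScatteredIn B) (hAB : A ⊆ B) : ScatteredIn A :=
  fun g hg => (h g hg).imp fun _ hq hA => hq (hAB hA)

theorem SigmaScatteredIn.mono {A B : Set X} (h : SigmaScatteredIn B) (hAB : A ⊆ B) :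
    SigmaScatteredIn A :=
  let ⟨S, hS, hs⟩ := h
  ⟨S, hAB.trans hS, hs⟩

theorem SigmaScatteredIn.preimage {f : X → Y} (hf : StrictMono f) {A : Set Y}
    (h : SigmaScatteredIn A) : SigmaScatteredIn (f ⁻¹' A) := by
  obtain ⟨S, hS, hs⟩ := h
  refine ⟨fun n => f ⁻¹' S n, ?_, fun n g hg => hs n (f ∘ g) (hf.comp hg)⟩
  rw [← preimage_iUnion]
  exact preimage_mono hS

theorem scatteredIn_of_subsingleton {A : Set X} (h : A.Subsingleton) : ScatteredIn A := by
  intro g hg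
  by_contra! hA
  exact (hg (zero_lt_one' ℚ)).ne (h (hA 0) (hA 1))

/-- A set is `σ`-scattered as soon as it has a countable colouring with scattered fibres. -/
theorem sigmaScatteredIn_of_fibers {ι : Type*} [Countable ι] {A : Set X} (c : X → ι)
    (h : ∀ i, ScatteredIn {x ∈ A | c x = i}) : SigmaScatteredIn A := by
  obtain ⟨f, hf⟩ := Countable.exists_injective_nat ι
  refine ⟨fun n => {x ∈ A | f (c x) = n}, fun x hx => mem_iUnion.2 ⟨_, hx, rfl⟩, fun n g hg => ?_⟩
  by_contra! hA
  obtain ⟨q, hq⟩ := h (c (g 0)) g hg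
  exact hq ⟨(hA q).1, hf ((hA q).2.trans (hA 0).2.symm)⟩

theorem sigmaScatteredIn_of_countable {A : Set X} (h : A.Countable) : SigmaScatteredIn A := by
  obtain rfl | hne := A.eq_empty_or_nonempty
  · exact ⟨fun _ => ∅, empty_subset _, fun _ => scatteredIn_of_subsingleton subsingleton_empty⟩
  obtain ⟨f, rfl⟩ := h.exists_eq_range hne
  exact ⟨fun n => {f n}, by rintro _ ⟨n, rfl⟩; exact mem_iUnion.2 ⟨n, rfl⟩,
    fun _ => scatteredIn_of_subsingleton subsingleton_singleton⟩

theorem exists_strictMono_rat_Ioo {a b : ℚ} (h : a < b) :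
    ∃ e : ℚ → ℚ, StrictMono e ∧ ∀ q, e q ∈ Ioo a b := by
  have : Nontrivial (Ioo a b) := by
    obtain ⟨c, hc⟩ := exists_between h
    obtain ⟨d, hd⟩ := exists_between hc.2
    exact ⟨⟨⟨c, hc⟩, ⟨d, hc.1.trans hd.1, hd.2⟩, fun e => hd.1.ne (congrArg Subtype.val e)⟩⟩
  obtain ⟨f⟩ := Order.embedding_from_countable_to_dense ℚ (Ioo a b)
  exact ⟨fun q => f q, fun _ _ h => f.strictMono h, fun q => (f q).2⟩

/-- A set is scattered if it has a monotone map to a scattered set with scattered fibres. -/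
theorem ScatteredIn.of_monotoneOn {A : Set X} {B : Set Y} {f : X → Y} (hf : MonotoneOn f A)
    (hAB : MapsTo f A B) (hB : ScatteredIn B) (hfib : ∀ y, ScatteredIn {x ∈ A | f x = y}) :
    ScatteredIn A := by
  intro g hg
  by_contra! hA
  by_cases hs : StrictMono (f ∘ g)
  · obtain ⟨q, hq⟩ := hB _ hs
    exact hq (hAB (hA q))
  -- Here `f ∘ g` is constant on a rational interval, and that interval contains a copy of `ℚ`, so a
  -- fibre would too.
  · simp only [StrictMono, not_forall, not_lt] at hs
    obtain ⟨a, b, hab, hle⟩ := hs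
    obtain ⟨e, he, hmem⟩ := exists_strictMono_rat_Ioo hab
    obtain ⟨q, hq⟩ := hfib (f (g a)) (g ∘ e) (hg.comp he)
    refine hq ⟨hA _, le_antisymm ?_ ?_⟩
    · exact (hf (hA _) (hA b) (hg (hmem q).2).le).trans hle
    · exact hf (hA a) (hA _) (hg (hmem q).1).le

theorem scatteredIn_ordinal (A : Set Ordinal.{u}) : ScatteredIn A := by
  intro g hg
  exact (not_strictAnti_of_wellFoundedLT (fun n : ℕ => g (-(n : ℚ)))
    fun a b hab => hg (neg_lt_neg (by exact_mod_cast hab))).elim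

theorem scatteredIn_ordinal_dual (A : Set Ordinal.{u}ᵒᵈ) : ScatteredIn A := by
  intro g hg
  obtain ⟨q, hq⟩ := scatteredIn_ordinal univ (fun q => OrderDual.ofDual (g (-q)))
    fun a b hab => hg (neg_lt_neg hab)
  exact (hq trivial).elim

/-- A family of sets each of which is split into two sets of the family by some point of `A`
forces a copy of the rationals in `A`. -/
theorem not_scatteredIn_of_splitting {ι : Type*} (I : ι → Set X) (c : ι → X) (l r : ι → ι)
    {A : Set X} (i₀ : ι) (hA : ∀ i, c i ∈ A) (hc : ∀ i, c i ∈ I i)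
    (hl : ∀ i, I (l i) ⊆ I i ∩ Iio (c i)) (hr : ∀ i, I (r i) ⊆ I i ∩ Ioi (c i)) :
    ¬ ScatteredIn A := by
  let step : ι → Bool → ι := fun i b => if b then r i else l i
  let node : ι → List Bool → ι := List.foldl step
  have hsub : ∀ (s : List Bool) i, c (node i s) ∈ I i := by
    intro s
    induction s with
    | nil => exact hc
    | cons b s ih =>
      intro i
      cases b
      · exact (hl i (ih (l i))).1
      · exact (hr i (ih (r i))).1
  have hlt : ∀ i s, c (node i (false :: s)) < c i := fun i s => (hl i (hsub s (l i))).2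
  have hgt : ∀ i s, c i < c (node i (true :: s)) := fun i s => (hr i (hsub s (r i))).2
  have happ : ∀ i s b, node i (s ++ [b]) = step (node i s) b := fun i s b => by
    simp [node, List.foldl_append]
  -- The nodes of the binary tree are densely ordered: diverging branches are separated by the node
  -- where they part, and between a node and a descendant lies a child of the descendant.
  have key : ∀ (s t : List Bool) i, c (node i s) < c (node i t) →
      ∃ v, c (node i s) < c (node i v) ∧ c (node i v) < c (node i t) := by
    intro s
    induction s with
    | nil =>
      rintro (_ | ⟨_ | _, t⟩) i h
      · exact (lt_irrefl _ h).elim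
      · exact (lt_asymm h (hlt i t)).elim
      · refine ⟨true :: (t ++ [false]), hgt i _, ?_⟩
        change c (node (r i) (t ++ [false])) < c (node (r i) t)
        rw [happ]
        exact hlt _ []
    | cons b s ih =>
      rintro (_ | ⟨b', t⟩) i h
      · cases b
        · refine ⟨false :: (s ++ [true]), ?_, hlt i _⟩
          change c (node (l i) s) < c (node (l i) (s ++ [true]))
          rw [happ]
          exact hgt _ []
        · exact (lt_asymm h (hgt i s)).elim
      · cases b <;> cases b'
        · obtain ⟨v, hv⟩ := ih t (l i) h
          exact ⟨false :: v, hv⟩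
        · exact ⟨[], hlt i s, hgt i t⟩
        · exact (lt_asymm h ((hlt i t).trans (hgt i s))).elim
        · obtain ⟨v, hv⟩ := ih t (r i) h
          exact ⟨true :: v, hv⟩
  let D : Set X := range fun s => c (node i₀ s)
  have : DenselyOrdered D := by
    refine ⟨?_⟩
    rintro ⟨_, s, rfl⟩ ⟨_, t, rfl⟩ h
    obtain ⟨v, hv⟩ := key s t i₀ h
    exact ⟨⟨_, v, rfl⟩, hv⟩
  have : Nontrivial D :=
    ⟨⟨⟨_, [], rfl⟩, ⟨_, [true], rfl⟩, fun e => (hgt i₀ []).ne (congrArg Subtype.val e)⟩⟩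
  obtain ⟨f⟩ := Order.embedding_from_countable_to_dense ℚ D
  intro h
  obtain ⟨q, hq⟩ := h (fun q => f q) fun _ _ h => f.strictMono h
  obtain ⟨s, hs⟩ := (f q).2
  exact hq (hs ▸ hA _)

end Scattered

/-! ### Ranks, parents and trace codes -/

section Rank

variable {X : Type*} [LinearOrder X]

/-- `z` is the last element before `x` of rank smaller than that of `x`. -/
def IsLeftParent (ρ : X → Ordinal.{u}) (x z : X) : Prop :=
  z < x ∧ ρ z < ρ x ∧ ∀ y, z < y → y ≤ x → ρ x ≤ ρ y

/-- `z` is the first element after `x` of rank smaller than that of `x`. -/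
def IsRightParent (ρ : X → Ordinal.{u}) (x z : X) : Prop :=
  x < z ∧ ρ z < ρ x ∧ ∀ y, x ≤ y → y < z → ρ x ≤ ρ y

theorem IsLeftParent.congr {ρ : X → Ordinal.{u}} {x y z : X} (hxy : ρ x = ρ y)
    (h : ∀ w ∈ uIcc x y, ρ x ≤ ρ w) (hz : IsLeftParent ρ x z) : IsLeftParent ρ y z := by
  obtain ⟨h1, h2, h3⟩ := hz
  have hzy : z < y := by
    by_contra! hle
    exact (h z (mem_uIcc.2 (Or.inr ⟨hle, h1.le⟩))).not_gt h2
  refine ⟨hzy, hxy ▸ h2, fun w hw hwy => hxy ▸ ?_⟩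
  rcases le_total w x with hwx | hwx
  · exact h3 w hw hwx
  · exact h w (mem_uIcc.2 (Or.inl ⟨hwx, hwy⟩))

theorem IsRightParent.congr {ρ : X → Ordinal.{u}} {x y z : X} (hxy : ρ x = ρ y)
    (h : ∀ w ∈ uIcc x y, ρ x ≤ ρ w) (hz : IsRightParent ρ x z) : IsRightParent ρ y z := by
  obtain ⟨h1, h2, h3⟩ := hz
  have hzy : y < z := by
    by_contra! hle
    exact (h z (mem_uIcc.2 (Or.inl ⟨h1.le, hle⟩))).not_gt h2
  refine ⟨hzy, hxy ▸ h2, fun w hw hwy => hxy ▸ ?_⟩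
  rcases le_total x w with hwx | hwx
  · exact h3 w hwx hwy
  · exact h w (mem_uIcc.2 (Or.inr ⟨hw, hwx⟩))

open Classical in
/-- The left parent of `x` if there is one, and otherwise the right parent. -/
noncomputable def parent (ρ : X → Ordinal.{u}) (x : X) : X :=
  @Classical.epsilon X ⟨x⟩
    (if ∃ z, IsLeftParent ρ x z then IsLeftParent ρ x else IsRightParent ρ x)

theorem parent_spec {ρ : X → Ordinal.{u}} {x : X}
    (h : (∃ z, IsLeftParent ρ x z) ∨ ∃ z, IsRightParent ρ x z) :
    IsLeftParent ρ x (parent ρ x) ∨ IsRightParent ρ x (parent ρ x) := by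
  unfold parent
  split_ifs with hl
  · exact Or.inl (Classical.epsilon_spec hl)
  · exact Or.inr (Classical.epsilon_spec (h.resolve_left hl))

/-- Both elements have the same candidates for parents, and `epsilon` applied to equal predicates
makes the same choice. -/
theorem parent_congr {ρ : X → Ordinal.{u}} {x y : X} (hxy : ρ x = ρ y)
    (h : ∀ w ∈ uIcc x y, ρ x ≤ ρ w) : parent ρ x = parent ρ y := by
  have h' : ∀ w ∈ uIcc y x, ρ y ≤ ρ w := by rwa [uIcc_comm, ← hxy]
  have e1 : IsLeftParent ρ x = IsLeftParent ρ y :=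
    funext fun z => propext ⟨.congr hxy h, .congr hxy.symm h'⟩
  have e2 : IsRightParent ρ x = IsRightParent ρ y :=
    funext fun z => propext ⟨.congr hxy h, .congr hxy.symm h'⟩
  unfold parent
  rw [e1, e2]

open Classical in
/-- The colours met on the way from `x` to an element without parent. -/
noncomputable def traceCode {ι : Type*} (ρ : X → Ordinal.{u}) (c : X → ι) (x : X) : List ι :=
  if ρ (parent ρ x) < ρ x then c x :: traceCode ρ c (parent ρ x) else [c x]
termination_by ρ x

variable {ι : Type*} {ρ : X → Ordinal.{u}} {c : X → ι}

theorem traceCode_of_lt {x : X} (h : ρ (parent ρ x) < ρ x) :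
    traceCode ρ c x = c x :: traceCode ρ c (parent ρ x) := by
  rw [traceCode, if_pos h]

theorem traceCode_ne_nil (x : X) : traceCode ρ c x ≠ [] := by
  rw [traceCode]
  split_ifs <;> simp

/-- If the rank of the elements of `uIcc z x` other than the parent `z` of `x` is at least that of
`x`, the traces starting at these elements pass through `z`. -/
theorem length_traceCode_parent_lt
    (h : ∀ x, ρ x = 0 ∨ (∃ z, IsLeftParent ρ x z) ∨ ∃ z, IsRightParent ρ x z)
    {x : X} (hx : ρ (parent ρ x) < ρ x)
    (hmin : ∀ y ∈ uIcc (parent ρ x) x, y ≠ parent ρ x → ρ x ≤ ρ y) (y : X)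
    (hy : y ∈ uIcc (parent ρ x) x) (hne : y ≠ parent ρ x) :
    (traceCode ρ c (parent ρ x)).length < (traceCode ρ c y).length := by
  induction hα : ρ y using WellFoundedLT.induction generalizing y with
  | _ α ih =>
  subst hα
  have hxy := hmin y hy hne
  have hy0 : ρ y ≠ 0 := ((zero_le).trans_lt (hx.trans_le hxy)).ne'
  have hp := parent_spec ((h y).resolve_left hy0)
  have hlt : ρ (parent ρ y) < ρ y := hp.elim (fun h => h.2.1) (fun h => h.2.1)
  rw [traceCode_of_lt hlt, List.length_cons]
  have hconv : ∀ w ∈ uIcc x y, w ∈ uIcc (parent ρ x) x ∧ w ≠ parent ρ x := by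
    intro w hw
    refine ⟨uIcc_subset_uIcc right_mem_uIcc hy hw, ?_⟩
    rintro rfl
    have : parent ρ x = y ∨ parent ρ x = x := by
      rcases mem_uIcc.1 hw with hw | hw <;> rcases mem_uIcc.1 hy with hy | hy
      · exact Or.inr (le_antisymm (hy.1.trans hy.2) hw.1)
      · exact Or.inl (le_antisymm hw.2 hy.2)
      · exact Or.inl (le_antisymm hy.1 hw.1)
      · exact Or.inr (le_antisymm hw.2 (hy.1.trans hy.2))
    rcases this with e | e
    · exact hne e.symm
    · exact hx.ne (congrArg ρ e)
  rcases hxy.eq_or_lt with he | hlt'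
  · rw [parent_congr he fun w hw => hmin w (hconv w hw).1 (hconv w hw).2]
    exact Nat.lt_succ_self _
  -- Both end points of the interval have rank below `ρ y`, so the nearest element of smaller rank
  -- on either side of `y` cannot lie beyond them.
  have hpm : parent ρ y ∈ uIcc (parent ρ x) x := by
    rcases hp with hp | hp
    · have key : ∀ v, ρ v < ρ y → v ≤ y → v ≤ parent ρ y := fun v hv hvy => by
        by_contra! hc
        exact (hp.2.2 v hc hvy).not_gt hv
      rcases mem_uIcc.1 hy with hy | hy
      · exact mem_uIcc.2 (Or.inl ⟨key _ (hx.trans hlt') hy.1, hp.1.le.trans hy.2⟩)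
      · exact mem_uIcc.2 (Or.inr ⟨key _ hlt' hy.1, hp.1.le.trans hy.2⟩)
    · have key : ∀ v, ρ v < ρ y → y ≤ v → parent ρ y ≤ v := fun v hv hvy => by
        by_contra! hc
        exact (hp.2.2 v hvy hc).not_gt hv
      rcases mem_uIcc.1 hy with hy | hy
      · exact mem_uIcc.2 (Or.inl ⟨hy.1.trans hp.1.le, key _ hlt' hy.2⟩)
      · exact mem_uIcc.2 (Or.inr ⟨hy.1.trans hp.1.le, key _ (hx.trans hlt') hy.2⟩)
  by_cases he : parent ρ y = parent ρ x
  · rw [he]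
    exact Nat.lt_succ_self _
  · exact (ih _ hlt _ hpm he rfl).trans (Nat.lt_succ_self _)

open Classical in
/-- A linear order is `σ`-scattered if it has a rank with `σ`-scattered level sets such that every
element of positive rank has a left or a right parent. -/
theorem sigmaScatteredIn_univ_of_rank
    (h : ∀ x, ρ x = 0 ∨ (∃ z, IsLeftParent ρ x z) ∨ ∃ z, IsRightParent ρ x z)
    (hσ : ∀ α, SigmaScatteredIn {x | ρ x = α}) : SigmaScatteredIn (univ : Set X) := by
  choose S hS hs using hσ
  have : ∀ x, ∃ n, x ∈ S (ρ x) n := fun x => mem_iUnion.1 (hS (ρ x) rfl)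
  choose n hn using this
  -- The colour records a scattered piece of the level set and the side of the parent. Fibres of the
  -- trace code are scattered by induction on the code: `parent` maps the fibre of `i :: l` to that
  -- of `l`.
  let c : X → ℕ × Bool := fun x => (n x, decide (IsLeftParent ρ x (parent ρ x)))
  have hroot : ∀ x, ¬ ρ (parent ρ x) < ρ x → ρ x = 0 := fun x hx => by
    by_contra h0
    exact hx ((parent_spec ((h x).resolve_left h0)).elim (fun h => h.2.1) (fun h => h.2.1))
  have hlevel : ∀ (α : Ordinal) (i : ℕ × Bool), ScatteredIn {x | ρ x = α ∧ c x = i} := by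
    rintro α i
    refine (hs α i.1).mono ?_
    rintro x ⟨rfl, rfl⟩
    exact hn x
  refine sigmaScatteredIn_of_fibers (traceCode ρ c) fun l => ?_
  simp only [mem_univ, true_and]
  induction l with
  | nil => exact scatteredIn_of_subsingleton fun x hx => (traceCode_ne_nil x hx).elim
  | cons i l ih =>
  by_cases hl : l = []
  · subst hl
    refine (hlevel 0 i).mono fun x hx => ?_
    rw [mem_ofPred_eq, traceCode] at hx
    split_ifs at hx with hlt
    · exact (traceCode_ne_nil _ (List.cons.inj hx).2).elim
    · exact ⟨hroot x hlt, (List.cons.inj hx).1⟩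
  have hF : ∀ x, traceCode ρ c x = i :: l →
      ρ (parent ρ x) < ρ x ∧ c x = i ∧ traceCode ρ c (parent ρ x) = l := by
    intro x hx
    rw [traceCode] at hx
    split_ifs at hx with hlt
    · exact ⟨hlt, List.cons.inj hx⟩
    · exact (hl (List.cons.inj hx).2.symm).elim
  have hspec : ∀ x, ρ (parent ρ x) < ρ x →
      IsLeftParent ρ x (parent ρ x) ∨ IsRightParent ρ x (parent ρ x) := fun x hx =>
    parent_spec ((h x).resolve_left ((zero_le).trans_lt hx).ne')
  -- Other elements between `x` and its parent have codes longer than `l`. This makes `parent`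
  -- monotone on the fibre of `i :: l`.
  have hthrough : ∀ x y, traceCode ρ c x = i :: l → traceCode ρ c y = l →
      y ∈ uIcc (parent ρ x) x → y = parent ρ x := by
    intro x y hx hy hmem
    by_contra hne
    obtain ⟨h1, -, h3⟩ := hF x hx
    refine (length_traceCode_parent_lt (c := c) h h1 ?_ y hmem hne).ne (by rw [h3, hy])
    intro w hw hwne
    rcases hspec x h1 with hp | hp
    · rw [uIcc_of_le hp.1.le] at hw
      exact hp.2.2 w (lt_of_le_of_ne hw.1 hwne.symm) hw.2
    · rw [uIcc_of_ge hp.1.le] at hw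
      exact hp.2.2 w hw.1 (lt_of_le_of_ne hw.2 hwne)
  rcases hi : i.2 with _ | _
  · have hR : ∀ x, traceCode ρ c x = i :: l → IsRightParent ρ x (parent ρ x) := by
      intro x hx
      obtain ⟨h1, h2, -⟩ := hF x hx
      refine (hspec x h1).resolve_left ?_
      rw [← h2] at hi
      exact of_decide_eq_false hi
    refine ScatteredIn.of_monotoneOn (f := parent ρ) (B := {x | traceCode ρ c x = l}) ?_
      (fun x hx => (hF x hx).2.2) ih fun w => ?_
    · intro x hx y hy hxy
      by_contra! hlt
      refine hlt.ne (hthrough x (parent ρ y) hx (hF y hy).2.2 ?_)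
      exact mem_uIcc.2 (Or.inr ⟨hxy.trans (hR y hy).1.le, hlt.le⟩)
    -- Among elements with a common right parent the rank increases towards it; for left parents it
    -- decreases to the right, hence the order dual below.
    · refine ScatteredIn.of_monotoneOn (f := ρ) (B := univ) ?_ (mapsTo_univ _ _)
        (scatteredIn_ordinal _) fun α => (hlevel α i).mono fun x hx => ⟨hx.2, (hF x hx.1.1).2.1⟩
      rintro x ⟨hx, rfl⟩ y ⟨hy, hyx⟩ hxy
      exact (hR x hx).2.2 y hxy (hyx ▸ (hR y hy).1)
  · have hL : ∀ x, traceCode ρ c x = i :: l → IsLeftParent ρ x (parent ρ x) := by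
      intro x hx
      obtain ⟨h1, h2, -⟩ := hF x hx
      rw [← h2] at hi
      exact of_decide_eq_true hi
    refine ScatteredIn.of_monotoneOn (f := parent ρ) (B := {x | traceCode ρ c x = l}) ?_
      (fun x hx => (hF x hx).2.2) ih fun w => ?_
    · intro x hx y hy hxy
      by_contra! hlt
      refine hlt.ne' (hthrough y (parent ρ x) hy (hF x hx).2.2 ?_)
      exact mem_uIcc.2 (Or.inl ⟨hlt.le, (hL x hx).1.le.trans hxy⟩)
    · refine ScatteredIn.of_monotoneOn (f := fun x => OrderDual.toDual (ρ x)) (B := univ) ?_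
        (mapsTo_univ _ _) (scatteredIn_ordinal_dual _)
        fun α => (hlevel (OrderDual.ofDual α) i).mono fun x hx => ⟨hx.2 ▸ rfl, (hF x hx.1.1).2.1⟩
      rintro x ⟨hx, rfl⟩ y ⟨hy, hyx⟩ hxy
      exact (hL y hy).2.2 x (hyx ▸ (hL x hx).1) hxy

end Rank

/-! ### Closure under finitary operations with countable values -/

section Closure

open Cardinal

variable {X : Type u} {Φ : Finset X → Set X}

/-- `N` is closed under the finitary operation `Φ` with sets as values. -/
def ClosedUnder (Φ : Finset X → Set X) (N : Set X) : Prop :=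
  ∀ s : Finset X, ↑s ⊆ N → Φ s ⊆ N

/-- The smallest set that contains `A` and is closed under `Φ`. -/
def opClosure (Φ : Finset X → Set X) (A : Set X) : Set X :=
  ⋂₀ {N | ClosedUnder Φ N ∧ A ⊆ N}

theorem subset_opClosure (A : Set X) : A ⊆ opClosure Φ A :=
  subset_sInter fun _ h => h.2

theorem opClosure_subset {A N : Set X} (hN : ClosedUnder Φ N) (h : A ⊆ N) :
    opClosure Φ A ⊆ N :=
  sInter_subset_of_mem ⟨hN, h⟩

theorem closedUnder_opClosure (A : Set X) : ClosedUnder Φ (opClosure Φ A) := fun s hs =>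
  subset_sInter fun _ hN => hN.1 s (hs.trans (opClosure_subset hN.1 hN.2))

theorem opClosure_mono {A B : Set X} (h : A ⊆ B) : opClosure Φ A ⊆ opClosure Φ B :=
  opClosure_subset (closedUnder_opClosure B) (h.trans (subset_opClosure B))

theorem ClosedUnder.iUnion {ι : Type*} [Nonempty ι] {f : ι → Set X}
    (hd : Directed (· ⊆ ·) f) (h : ∀ i, ClosedUnder Φ (f i)) : ClosedUnder Φ (⋃ i, f i) := by
  intro s hs
  obtain ⟨i, hi⟩ := hd.exists_mem_subset_of_finset_subset_biUnion hs
  exact (h i s hi).trans (subset_iUnion f i)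

theorem ClosedUnder.of_le {Ψ : Finset X → Set X} (h : ∀ s, Φ s ⊆ Ψ s) {N : Set X}
    (hN : ClosedUnder Ψ N) : ClosedUnder Φ N :=
  fun s hs => (h s).trans (hN s hs)

/-- The closure is reached in `ω` steps, each adding countably many elements for every finite
subset. -/
theorem mk_opClosure_le (hΦ : ∀ s, (Φ s).Countable) (A : Set X) :
    #(opClosure Φ A) ≤ max #A ℵ₀ := by
  let step : Set X → Set X := fun B =>
    B ∪ ⋃ s : Finset B, Φ (s.map (Function.Embedding.subtype _))
  let T : ℕ → Set X := fun n => step^[n] A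
  have hT : ∀ n, T (n + 1) = step (T n) := fun n => Function.iterate_succ_apply' _ _ _
  have hmono : Monotone T := monotone_nat_of_le_succ fun n => by
    rw [hT]
    exact subset_union_left
  have hclosed : ClosedUnder Φ (⋃ n, T n) := by
    intro s hs
    obtain ⟨n, hn⟩ := hmono.directed_le.exists_mem_subset_of_finset_subset_biUnion hs
    refine subset_trans ?_ (subset_iUnion T (n + 1))
    rw [hT]
    refine subset_trans ?_ subset_union_right
    classical
    rw [← Finset.subtype_map_of_mem (p := (· ∈ T n)) fun x hx => hn hx]
    exact subset_iUnion (fun s : Finset (T n) => Φ (s.map (Function.Embedding.subtype _))) _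
  have hle : ∀ n, #(T n) ≤ max #A ℵ₀ := by
    intro n
    induction n with
    | zero => exact le_max_left _ _
    | succ n ih =>
      rw [hT]
      refine (mk_union_le _ _).trans (add_le_of_le (le_max_right _ _) ih ?_)
      refine (mk_iUnion_le _).trans (mul_le_of_le (le_max_right _ _) ?_ ?_)
      · rcases finite_or_infinite (T n) with hf | hf
        · have := Fintype.ofFinite (T n)
          exact (mk_lt_aleph0.le).trans (le_max_right _ _)
        · rw [mk_finset_of_infinite]
          exact ih
      · exact (ciSup_le' fun s => (hΦ _).le_aleph0).trans (le_max_right _ _)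
  refine (mk_le_mk_of_subset (opClosure_subset hclosed (subset_iUnion T 0))).trans ?_
  rw [← lift_uzero #(⋃ n, T n)]
  refine (mk_iUnion_le_lift T).trans (mul_le_of_le (le_max_right _ _) ?_ ?_)
  · simp
  · exact ciSup_le' fun n => by simpa using hle n

theorem countable_opClosure (hΦ : ∀ s, (Φ s).Countable) {A : Set X} (hA : A.Countable) :
    (opClosure Φ A).Countable := by
  rw [← le_aleph0_iff_set_countable]
  exact (mk_opClosure_le hΦ A).trans (max_le hA.le_aleph0 le_rfl)

end Closure

/-! ### Induction on the cardinality of closed sets -/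

section Induction

open Cardinal

variable {X : Type u} [LinearOrder X] {Φ : Finset X → Set X}

/-- `z` is the last element of `N` before `x`, or the first one after `x`. -/
def IsNeighbour (N : Set X) (x z : X) : Prop :=
  (z < x ∧ ∀ y ∈ N, z < y → x < y) ∨ (x < z ∧ ∀ y ∈ N, y < z → y < x)

/-- If every `Φ`-closed set `N` provides each `x ∈ A \ N` with a neighbour in `N ∩ A`, the trace
of `A` on a `Φ`-closed set is `σ`-scattered. -/
theorem sigmaScatteredIn_of_closedUnder (hΦ : ∀ s, (Φ s).Countable) {A : Set X}
    (hA : ∀ N, ClosedUnder Φ N → ∀ x ∈ A, x ∉ N → ∃ z ∈ N ∩ A, IsNeighbour N x z)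
    {N : Set X} (hN : ClosedUnder Φ N) : SigmaScatteredIn (N ∩ A) := by
  induction hκ : #N using WellFoundedLT.induction generalizing N with
  | _ κ ih =>
  subst hκ
  rcases le_or_gt #N ℵ₀ with hc | hc
  · exact sigmaScatteredIn_of_countable
      ((le_aleph0_iff_set_countable.1 hc).mono inter_subset_left)
  -- Well-order `N` in its least order type. The closures `R α` of initial segments have smaller
  -- cardinality, and the rank `ρ x` is the first `α` with `x ∈ R α`; the level sets fall under the
  -- induction hypothesis.
  obtain ⟨r, hr, hord⟩ := exists_ord_eq N
  let f : N → Ordinal.{u} := Ordinal.typein r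
  have hf : ∀ x, f x < ord #N := fun x => hord ▸ Ordinal.typein_lt_type r x
  let R : Ordinal.{u} → Set X := fun α => opClosure Φ (Subtype.val '' {x : N | f x < α})
  have hRmono : Monotone R := fun α β h =>
    opClosure_mono (image_mono fun x (hx : f x < α) => hx.trans_le h)
  have hRN : ∀ α, R α ⊆ N := fun α =>
    opClosure_subset hN (by rintro _ ⟨x, -, rfl⟩; exact x.2)
  have hRcard : ∀ α < ord #N, #(R α) < #N := by
    intro α hα
    rw [hord] at hα
    obtain ⟨a, rfl⟩ := Ordinal.typein_surj r hα
    refine (mk_opClosure_le hΦ _).trans_lt (max_lt ?_ hc)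
    refine mk_image_le.trans_lt ?_
    have := card_typein_lt (r := r) a hord
    rw [Ordinal.card_typein] at this
    refine lt_of_eq_of_lt (congrArg Cardinal.mk ?_) this
    exact congrArg (fun p : N → Prop => {x // p x}) (funext fun x =>
      propext (Ordinal.typein_lt_typein r))
  have hmem : ∀ x : N, x.1 ∈ R (f x + 1) := fun x =>
    subset_opClosure _ ⟨x, Order.lt_succ (f x), rfl⟩
  let ρ : X → Ordinal.{u} := fun x => sInf {α | x ∈ R α}
  have hρ : ∀ x ∈ N, x ∈ R (ρ x) := fun x hx => csInf_mem (s := {α | x ∈ R α}) ⟨_, hmem ⟨x, hx⟩⟩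
  have hρle : ∀ x α, x ∈ R α → ρ x ≤ α := fun x α h => csInf_le' h
  have hρlt : ∀ x ∈ N, ρ x < ord #N := fun x hx =>
    (hρle x _ (hmem ⟨x, hx⟩)).trans_lt ((isSuccLimit_ord hc.le).succ_lt (hf ⟨x, hx⟩))
  have hmain : SigmaScatteredIn (univ : Set ↥(N ∩ A)) := by
    refine sigmaScatteredIn_univ_of_rank (ρ := fun x : ↥(N ∩ A) => ρ x) ?_ fun α => ?_
    · rintro ⟨x, hxN, hxA⟩
      rcases eq_or_ne (ρ x) 0 with h0 | h0
      · exact Or.inl h0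
      right
      have : Nonempty (Iio (ρ x)) := ⟨⟨0, pos_iff_ne_zero.2 h0⟩⟩
      -- The union is closed and consists of the elements of `N` of rank below `ρ x`, so a neighbour
      -- of `x` in it is a parent of `x`.
      have hM : ∀ y ∈ N, y ∉ (⋃ β : Iio (ρ x), R β) → ρ x ≤ ρ y := by
        intro y hy hyM
        by_contra! hlt
        exact hyM (mem_iUnion.2 ⟨⟨ρ y, hlt⟩, hρ y hy⟩)
      have hM' : ∀ y ∈ (⋃ β : Iio (ρ x), R β), ρ y < ρ x := by
        intro y hy
        obtain ⟨β, hβ⟩ := mem_iUnion.1 hy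
        exact (hρle _ _ hβ).trans_lt β.2
      obtain ⟨z, ⟨hzM, hzA⟩, hz⟩ := hA (⋃ β : Iio (ρ x), R β)
        (.iUnion (Monotone.directed_le fun a b h => hRmono h) fun β => closedUnder_opClosure _)
        x hxA fun h => (hM' x h).false
      have hzN : z ∈ N := by
        obtain ⟨β, hβ⟩ := mem_iUnion.1 hzM
        exact hRN _ hβ
      refine hz.imp (fun h => ⟨⟨z, hzN, hzA⟩, h.1, hM' z hzM, ?_⟩)
        (fun h => ⟨⟨z, hzN, hzA⟩, h.1, hM' z hzM, ?_⟩)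
      · rintro ⟨y, hy⟩ hzy hyx
        exact hM y hy.1 fun hyM => (h.2 y hyM hzy).not_ge hyx
      · rintro ⟨y, hy⟩ hxy hyz
        exact hM y hy.1 fun hyM => (h.2 y hyM hyz).not_ge hxy
    · rcases lt_or_ge α (ord #N) with hα | hα
      · refine ((ih _ (hRcard α hα) (closedUnder_opClosure _) rfl).preimage
          (f := Subtype.val) fun _ _ h => h).mono ?_
        rintro ⟨x, hx⟩ rfl
        exact ⟨hρ x hx.1, hx.2⟩
      · refine (sigmaScatteredIn_of_countable countable_empty).mono ?_
        rintro ⟨x, hx⟩ rfl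
        exact (hρlt x hx.1).not_ge hα
  obtain ⟨S, hS, hs⟩ := hmain
  refine (isSigmaScattered_iff (N ∩ A)).1 ⟨S, univ_subset_iff.1 hS, fun n =>
    (isScatteredOrder_iff _).2 (hs n)⟩

end Induction

/-! ### Two-sided limits and gaps -/

section Order

variable {K : Type u} [LinearOrder K]

theorem uIcc_eq_pair_of_covBy {a b : K} (h : a ⋖ b) : uIcc a b = {a, b} := by
  rw [uIcc_of_le h.le, h.Icc_eq]

theorem left_mem_isolatedPts {a b : K} (h : a ⋖ b) : a ∈ isolatedPts K :=
  ⟨b, h.lt.ne', uIcc_eq_pair_of_covBy h⟩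

/-- The point `x` is a limit of points of `N` from either side where it is not an end point. -/
def IsTwoSidedLimit (N : Set K) (x : K) : Prop :=
  (∀ y < x, ∃ c ∈ N, y < c ∧ c < x) ∧ ∀ y, x < y → ∃ c ∈ N, x < c ∧ c < y

theorem not_isTwoSidedLimit_of_mem_isolatedPts {x : K} (hx : x ∈ isolatedPts K) (N : Set K) :
    ¬ IsTwoSidedLimit N x := by
  rintro ⟨hl, hr⟩
  obtain ⟨y, hne, hy⟩ := hx
  have key : ∀ c ∈ uIcc x y, c = x ∨ c = y := fun c hc => by rwa [hy] at hc
  rcases hne.lt_or_gt with h | h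
  · obtain ⟨c, -, h1, h2⟩ := hl y h
    rcases key c (mem_uIcc.2 (Or.inr ⟨h1.le, h2.le⟩)) with rfl | rfl
    · exact h2.false
    · exact h1.false
  · obtain ⟨c, -, h1, h2⟩ := hr y h
    rcases key c (mem_uIcc.2 (Or.inl ⟨h1.le, h2.le⟩)) with rfl | rfl
    · exact h1.false
    · exact h2.false

/-- `N` misses `[a, b]` and accumulates both at `a` from the left and at `b` from the right. -/
def IsGap (N : Set K) (a b : K) : Prop :=
  a < b ∧ (∀ c ∈ N, c < a ∨ b < c) ∧ (∀ y < a, ∃ c ∈ N, y < c ∧ c < a) ∧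
    ∀ y, b < y → ∃ c ∈ N, b < c ∧ c < y

variable (K) in
/-- The countable subsets of `K` without gaps contain all countable sets closed under some
finitary operation with countable values. -/
def IsGapFree : Prop :=
  ∃ Φ : Finset K → Set K, (∀ s, (Φ s).Countable) ∧
    ∀ N : Set K, N.Countable → ClosedUnder Φ N → ∀ a b, ¬ IsGap N a b

end Order

/-! ### Gaps and jumps in compact lines -/

section Compact

variable {K : Type u} [LinearOrder K] [TopologicalSpace K] [OrderTopology K] [CompactSpace K]

theorem exists_isLUB_of_nonempty {A : Set K} (hA : A.Nonempty) : ∃ a, IsLUB A a := by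
  obtain ⟨a, -, ha⟩ := isClosed_closure.isCompact.exists_isLUB hA.closure
  exact ⟨a, (isLUB_iff_of_subset_of_subset_closure subset_closure le_rfl).2 ha⟩

theorem exists_isGLB_of_nonempty {A : Set K} (hA : A.Nonempty) : ∃ a, IsGLB A a := by
  obtain ⟨a, -, ha⟩ := isClosed_closure.isCompact.exists_isGLB hA.closure
  exact ⟨a, (isGLB_iff_of_subset_of_subset_closure subset_closure le_rfl).2 ha⟩

variable (K) in
theorem exists_countable_bounds :
    ∃ E : Set K, E.Countable ∧ ∀ x, (∃ m ∈ E, m ≤ x) ∧ ∃ m ∈ E, x ≤ m := by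
  rcases isEmpty_or_nonempty K with h | h
  · exact ⟨∅, countable_empty, fun x => (h.false x).elim⟩
  obtain ⟨m, -, hm⟩ := isCompact_univ.exists_isLeast (univ_nonempty (α := K))
  obtain ⟨m', -, hm'⟩ := isCompact_univ.exists_isGreatest (univ_nonempty (α := K))
  exact ⟨{m, m'}, (countable_singleton _).insert _, fun x =>
    ⟨⟨m, by simp, hm trivial⟩, ⟨m', by simp, hm' trivial⟩⟩⟩

/-- Take for `a` the supremum of `N` below `x` and for `b` the infimum of `N` above `x`; neither is
attained. If they were equal, `x` would be a two-sided limit of `N`. -/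
theorem exists_isGap {N : Set K} {x : K} (hx : x ∉ N) (hE : ∃ c ∈ N, c ≤ x) (hE' : ∃ c ∈ N, x ≤ c)
    (hl : ∀ c ∈ N, c < x → ∃ c' ∈ N, c < c' ∧ c' < x)
    (hr : ∀ c ∈ N, x < c → ∃ c' ∈ N, x < c' ∧ c' < c) (hlim : ¬ IsTwoSidedLimit N x) :
    ∃ a b, IsGap N a b := by
  have hne : ∀ c ∈ N, c ≠ x := fun c hc h => hx (h ▸ hc)
  obtain ⟨c₀, hc₀, hc₀x⟩ := hE
  obtain ⟨c₁, hc₁, hc₁x⟩ := hE'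
  obtain ⟨a, ha⟩ := exists_isLUB_of_nonempty (A := N ∩ Iio x)
    ⟨c₀, hc₀, lt_of_le_of_ne hc₀x (hne _ hc₀)⟩
  obtain ⟨b, hb⟩ := exists_isGLB_of_nonempty (A := N ∩ Ioi x)
    ⟨c₁, hc₁, lt_of_le_of_ne hc₁x (hne _ hc₁).symm⟩
  have hax : a ≤ x := ha.2 fun c hc => hc.2.le
  have hxb : x ≤ b := hb.2 fun c hc => hc.2.le
  have hlta : ∀ c ∈ N, c < x → c < a := fun c hc hcx => by
    obtain ⟨c', h1, h2, h3⟩ := hl c hc hcx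
    exact h2.trans_le (ha.1 ⟨h1, h3⟩)
  have hgtb : ∀ c ∈ N, x < c → b < c := fun c hc hcx => by
    obtain ⟨c', h1, h2, h3⟩ := hr c hc hcx
    exact (hb.1 ⟨h1, h2⟩).trans_lt h3
  have hla : ∀ y < a, ∃ c ∈ N, y < c ∧ c < a := fun y hy => by
    obtain ⟨c, hc, hyc⟩ := (lt_isLUB_iff ha).1 hy
    exact ⟨c, hc.1, hyc, hlta c hc.1 hc.2⟩
  have hgb : ∀ y, b < y → ∃ c ∈ N, b < c ∧ c < y := fun y hy => by
    obtain ⟨c, hc, hyc⟩ := (isGLB_lt_iff hb).1 hy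
    exact ⟨c, hc.1, hgtb c hc.1 hc.2, hyc⟩
  refine ⟨a, b, lt_of_le_of_ne (hax.trans hxb) ?_, fun c hc => ?_, hla, hgb⟩
  · rintro rfl
    obtain rfl : x = a := le_antisymm hxb hax
    exact hlim ⟨hla, hgb⟩
  · exact (hne c hc).lt_or_gt.imp (hlta c hc) (hgtb c hc)

/-- In a zero-dimensional compact line, any two points are separated by a jump. -/
theorem exists_covBy_between (hK : IsZeroDimensional K) {x y : K} (hxy : x < y) :
    ∃ u v, x ≤ u ∧ u ⋖ v ∧ v ≤ y := by
  obtain ⟨C, hC, hxC, hCy⟩ := hK.exists_subset_of_mem_open (mem_Iio.2 hxy) isOpen_Iio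
  obtain ⟨v, ⟨⟨hxv, hvy⟩, hvC⟩, hv⟩ :=
    (isClosed_Icc.inter hC.compl.isClosed : IsClosed (Icc x y ∩ Cᶜ)).isCompact.exists_isLeast
      ⟨y, ⟨hxy.le, le_rfl⟩, fun h => (hCy h).false⟩
  have hxv' : x < v := lt_of_le_of_ne hxv fun h => hvC (h ▸ hxC)
  -- As `v` is the first point of `[x, y]` outside the clopen set `C`, a left neighbourhood of `v`
  -- outside `C` has nothing strictly between its end `t` and `v`.
  obtain ⟨t, ⟨hxt, htv⟩, ht⟩ :=
    exists_Ioc_subset_of_mem_nhds' (hC.compl.isOpen.mem_nhds hvC) hxv'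
  refine ⟨t, v, hxt, ⟨htv, fun w htw hwv => ?_⟩, hvy⟩
  exact (hv ⟨⟨hxt.trans htw.le, hwv.le.trans hvy⟩, ht ⟨htw, hwv.le⟩⟩).not_gt hwv

/-- If `N` does not capture `x`, then infinitely many points of `N` lie between `x` and any `z ∈ N`;
so `x ∉ N` and `N` has no last element before `x` and no first one after it. As a point of `L`, `x`
is no two-sided limit, so a gap arises. -/
theorem IsGapFree.not_isStationaryFamily (h : IsGapFree K) :
    ¬ IsStationaryFamily (nonCapturing K) := by
  obtain ⟨Φ, hΦ, hgap⟩ := h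
  obtain ⟨E, hE, hEb⟩ := exists_countable_bounds K
  have hΨ : ∀ s, (Φ s ∪ E).Countable := fun s => (hΦ s).union hE
  intro hst
  obtain ⟨N, ⟨hNc, x, hx, hcap⟩, -, hN⟩ := hst
    {N | N.Countable ∧ ClosedUnder (fun s => Φ s ∪ E) N}
    { subset := fun N hN => hN.1
      closed := fun M hM h => ⟨countable_iUnion fun n => (h n).1,
        .iUnion hM.directed_le fun n => (h n).2⟩
      unbounded := fun M hM => ⟨_, ⟨countable_opClosure hΨ hM, closedUnder_opClosure M⟩,
        subset_opClosure M⟩ }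
  have hEN : E ⊆ N := subset_union_right.trans (hN ∅ (by simp))
  have hinf : ∀ z ∈ N, (N ∩ isolatedPts K ∩ uIoo x z).Infinite := fun z hz hfin =>
    hcap ⟨z, hz, hfin⟩
  obtain ⟨a, b, hab⟩ := exists_isGap (N := N) (x := x)
    (fun hxN => hinf x hxN (by simp))
    ((hEb x).1.imp fun m h => ⟨hEN h.1, h.2⟩) ((hEb x).2.imp fun m h => ⟨hEN h.1, h.2⟩)
    (fun c hc hcx => by
      obtain ⟨c', ⟨h1, -⟩, h2⟩ := (hinf c hc).nonempty
      rw [uIoo_of_ge hcx.le] at h2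
      exact ⟨c', h1, h2⟩)
    (fun c hc hcx => by
      obtain ⟨c', ⟨h1, -⟩, h2⟩ := (hinf c hc).nonempty
      rw [uIoo_of_le hcx.le] at h2
      exact ⟨c', h1, h2⟩)
    (not_isTwoSidedLimit_of_mem_isolatedPts hx N)
  exact hgap N hNc (hN.of_le fun s => subset_union_left) a b hab

end Compact

/-! ### Clubs and finitary operations -/

section Club

variable {X : Type u}

/-- Every club contains all countable sets closed under some finitary operation with countable
values. -/
theorem IsClubFamily.exists_operation {Δ : Set (Set X)} (hΔ : IsClubFamily Δ) :
    ∃ Φ : Finset X → Set X, (∀ s, (Φ s).Countable) ∧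
      ∀ N : Set X, N.Countable → ClosedUnder Φ N → N ∈ Δ := by
  have : ∀ A : Set X, ∃ B, A.Countable → B ∈ Δ ∧ A ⊆ B := fun A => by
    by_cases hA : A.Countable
    · obtain ⟨B, hB⟩ := hΔ.unbounded A hA
      exact ⟨B, fun _ => hB⟩
    · exact ⟨∅, fun h => (hA h).elim⟩
  choose G hG using this
  -- The member `F (n + 1) s` of `Δ` contains `s` and every `F n t` with `t ⊆ s`. Taking level
  -- `s.card` makes `Φ` monotone, because proper subsets have fewer elements. A countable closed set
  -- is then the increasing union of `Φ (s n)` along finite sets exhausting it.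
  let F : ℕ → Finset X → Set X := fun n => Nat.rec (fun s => G s)
    (fun _ f s => G (↑s ∪ ⋃ t ∈ s.powerset, f t)) n
  have hFc : ∀ n s, F n s ∈ Δ := by
    intro n
    induction n with
    | zero => exact fun s => (hG _ s.countable_toSet).1
    | succ n ih =>
      exact fun s => (hG _ (s.countable_toSet.union
        (s.powerset.countable_toSet.biUnion fun t _ => hΔ.subset (ih t)))).1
  have hFsucc : ∀ n (s : Finset X), ↑s ∪ ⋃ t ∈ s.powerset, F n t ⊆ F (n + 1) s := fun n s =>
    (hG _ (s.countable_toSet.union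
        (s.powerset.countable_toSet.biUnion fun t _ => hΔ.subset (hFc n t)))).2
  have hFsub : ∀ n s t, s ⊆ t → F n s ⊆ F (n + 1) t := fun n s t h =>
    (subset_biUnion_of_mem (u := F n) (Finset.mem_coe.2 (Finset.mem_powerset.2 h))).trans
      (subset_union_right.trans (hFsucc n t))
  have hFself : ∀ n (s : Finset X), ↑s ⊆ F n s := by
    rintro (_ | n) s
    · exact (hG _ s.countable_toSet).2
    · exact subset_union_left.trans (hFsucc n s)
  have hFmono : ∀ s, Monotone fun n => F n s := fun s =>
    monotone_nat_of_le_succ fun n => hFsub n s s le_rfl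
  let Φ : Finset X → Set X := fun s => F s.card s
  have hΦmono : Monotone Φ := by
    intro s t hst
    rcases hst.eq_or_ssubset with rfl | h
    · exact le_rfl
    · obtain ⟨n, hn⟩ := Nat.exists_eq_add_of_lt (Finset.card_lt_card h)
      change F s.card s ⊆ F t.card t
      rw [hn]
      exact (hFmono s (Nat.le_add_right _ n)).trans (hFsub _ s t hst)
  refine ⟨Φ, fun s => hΔ.subset (hFc _ s), fun N hNc hN => ?_⟩
  have hex : ∃ s : ℕ → Finset X, Monotone s ∧ N = ⋃ n, (s n : Set X) := by
    classical
    rcases N.eq_empty_or_nonempty with rfl | hne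
    · exact ⟨fun _ => ∅, monotone_const, by simp⟩
    obtain ⟨f, rfl⟩ := hNc.exists_eq_range hne
    refine ⟨fun n => (Finset.range n).image f,
      fun m n h => Finset.image_subset_image (Finset.range_mono h), ?_⟩
    ext x
    simp only [mem_range, mem_iUnion, Finset.coe_image, Finset.coe_range, mem_image, mem_Iio]
    exact ⟨fun ⟨n, hn⟩ => ⟨n + 1, n, Nat.lt_succ_self n, hn⟩, fun ⟨_, n, _, hn⟩ => ⟨n, hn⟩⟩
  obtain ⟨s, hs, hNs⟩ := hex
  have : N = ⋃ n, Φ (s n) := by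
    refine Subset.antisymm ?_ (iUnion_subset fun n => hN _ ?_)
    · conv_lhs => rw [hNs]
      exact iUnion_mono fun n => hFself _ _
    · conv_rhs => rw [hNs]
      exact subset_iUnion (fun n => (s n : Set X)) n
  rw [this]
  exact hΔ.closed _ (hΦmono.comp hs) fun n => hFc _ _

end Club

/-! ### Non-stationarity, gap-freeness and `σ`-scatteredness -/

section Compact

variable {K : Type u} [LinearOrder K] [TopologicalSpace K] [OrderTopology K] [CompactSpace K]

/-- A gap contains the left end `x` of a jump. If `N` captured `x` from `z`, only finitely many
points of `N ∩ L` would lie between `z` and the gap. But `N` accumulates at the gap, and with any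
two points it contains a point of `L` between them. -/
theorem isGapFree_of_not_isStationaryFamily (hK : IsZeroDimensional K)
    (h : ¬ IsStationaryFamily (nonCapturing K)) : IsGapFree K := by
  simp only [IsStationaryFamily, not_forall, not_nonempty_iff_eq_empty] at h
  obtain ⟨Δ, hΔ, hdisj⟩ := h
  obtain ⟨Φ, hΦ, hN⟩ := hΔ.exists_operation
  obtain ⟨E, hE, hEb⟩ := exists_countable_bounds K
  have : ∀ x y : K, ∃ l, x < y → l ∈ isolatedPts K ∧ x ≤ l ∧ l ≤ y := fun x y => by
    by_cases hxy : x < y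
    · obtain ⟨a, b, h1, h2, h3⟩ := exists_covBy_between hK hxy
      exact ⟨a, fun _ => ⟨left_mem_isolatedPts h2, h1, h2.le.trans h3⟩⟩
    · exact ⟨x, fun h => (hxy h).elim⟩
  choose j hj using this
  refine ⟨fun s => Φ s ∪ (E ∪ image2 j s s), fun s => (hΦ s).union (hE.union
    (s.countable_toSet.image2 s.countable_toSet j)), fun N hNc hcl a b hab => ?_⟩
  obtain ⟨hlt, hmiss, hl, hr⟩ := hab
  obtain ⟨x, v, hax, hxv, hvb⟩ := exists_covBy_between hK hlt
  have hxb : x ≤ b := hxv.le.trans hvb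
  have hEN : E ⊆ N := subset_union_left.trans (subset_union_right.trans (hcl ∅ (by simp)))
  have hjN : ∀ c ∈ N, ∀ c' ∈ N, j c c' ∈ N := by
    classical
    intro c hc c' hc'
    refine hcl {c, c'} ?_ (Or.inr (Or.inr (mem_image2_of_mem (by simp) (by simp))))
    simp [insert_subset_iff, hc, hc']
  have hcap : Captures N x := by
    by_contra hcap
    exact (hdisj ▸ (⟨⟨hNc, x, left_mem_isolatedPts hxv, hcap⟩,
      hN N hNc (hcl.of_le fun s => subset_union_left)⟩ : N ∈ nonCapturing K ∩ Δ) :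
        N ∈ (∅ : Set (Set K)))
  obtain ⟨z, hzN, hfin⟩ := hcap
  rcases hmiss z hzN with hz | hz
  · have hT : (N ∩ isolatedPts K ∩ Ioo z a).Finite := hfin.subset fun w hw =>
      ⟨hw.1, by rw [uIoo_of_ge (hz.le.trans hax)]; exact ⟨hw.2.1, hw.2.2.trans_le hax⟩⟩
    have step : ∀ t, t < a → ∃ w ∈ N ∩ isolatedPts K, t < w ∧ w < a := fun t ht => by
      obtain ⟨c, hc, htc, hca⟩ := hl t ht
      obtain ⟨c', hc', hcc', hca'⟩ := hl c hca
      obtain ⟨h1, h2, h3⟩ := hj c c' hcc'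
      exact ⟨_, ⟨hjN c hc c' hc', h1⟩, htc.trans_le h2, h3.trans_lt hca'⟩
    obtain ⟨w, hw, hzw, hwa⟩ := step z hz
    obtain ⟨t, ht, hmax⟩ := hT.exists_maximal ⟨w, hw, hzw, hwa⟩
    obtain ⟨w', hw', htw', hwa'⟩ := step t ht.2.2
    exact (hmax ⟨hw', ht.2.1.trans htw', hwa'⟩ htw'.le).not_gt htw'
  · have hT : (N ∩ isolatedPts K ∩ Ioo b z).Finite := hfin.subset fun w hw =>
      ⟨hw.1, by rw [uIoo_of_le (hxb.trans hz.le)]; exact ⟨hxb.trans_lt hw.2.1, hw.2.2⟩⟩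
    have step : ∀ t, b < t → ∃ w ∈ N ∩ isolatedPts K, b < w ∧ w < t := fun t ht => by
      obtain ⟨c, hc, hbc, hct⟩ := hr t ht
      obtain ⟨c', hc', hbc', hcc'⟩ := hr c hbc
      obtain ⟨h1, h2, h3⟩ := hj c' c hcc'
      exact ⟨_, ⟨hjN c' hc' c hc, h1⟩, hbc'.trans_le h2, h3.trans_lt hct⟩
    obtain ⟨w, hw, hbw, hwz⟩ := step z hz
    obtain ⟨t, ht, hmin⟩ := hT.exists_minimal ⟨w, hw, hbw, hwz⟩
    obtain ⟨w', hw', hbw', hwt'⟩ := step t ht.2.1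
    exact (hmin ⟨hw', hbw', hwt'.trans ht.2.2⟩ hwt'.le).not_gt hwt'

/-- The cardinality induction is applied not to `L` but to the larger set `A` of points that are no
two-sided limit of a countable set, since neighbours must belong to the same set. -/
theorem IsGapFree.sigmaScatteredIn (h : IsGapFree K) : SigmaScatteredIn (isolatedPts K) := by
  obtain ⟨Φ, hΦ, hgap⟩ := h
  obtain ⟨E, hE, hEb⟩ := exists_countable_bounds K
  let A : Set K := {x | ¬ ∃ C : Set K, C.Countable ∧ IsTwoSidedLimit C x}
  have : ∀ x, ∃ C : Set K, C.Countable ∧ (x ∉ A → IsTwoSidedLimit C x) := fun x => by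
    by_cases hx : x ∈ A
    · exact ⟨∅, countable_empty, fun h => (h hx).elim⟩
    · obtain ⟨C, hC⟩ := not_not.1 hx
      exact ⟨C, hC.1, fun _ => hC.2⟩
  choose C hC hCx using this
  let Ψ : Finset K → Set K := fun s => Φ s ∪ (E ∪ ⋃ x ∈ s, C x)
  have hΨ : ∀ s, (Ψ s).Countable := fun s =>
    (hΦ s).union (hE.union (s.countable_toSet.biUnion fun x _ => hC x))
  have hmain := sigmaScatteredIn_of_closedUnder (A := A) hΨ ?_ (N := univ)
    fun _ _ => subset_univ _
  · refine hmain.mono fun x hx => ⟨trivial, ?_⟩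
    rintro ⟨D, -, hD⟩
    exact not_isTwoSidedLimit_of_mem_isolatedPts hx D hD
  intro N hN x hxA hxN
  by_contra! hno
  have hCN : ∀ z ∈ N, C z ⊆ N := fun z hz =>
    subset_trans (by simp) ((subset_union_right.trans subset_union_right).trans
      (hN {z} (by simpa using hz)))
  -- A neighbour outside `A` is impossible: `C z ⊆ N` would have points between it and `x`.
  have hno' : ∀ z ∈ N, ¬ IsNeighbour N x z := by
    intro z hz hnb
    have hzA : z ∉ A := fun hzA => hno z ⟨hz, hzA⟩ hnb
    rcases hnb with ⟨hzx, hnb⟩ | ⟨hxz, hnb⟩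
    · obtain ⟨c, hc, h1, h2⟩ := (hCx z hzA).2 x hzx
      exact (hnb c (hCN z hz hc) h1).not_gt h2
    · obtain ⟨c, hc, h1, h2⟩ := (hCx z hzA).1 x hxz
      exact (hnb c (hCN z hz hc) h2).not_gt h1
  have hne : ∀ c ∈ N, c ≠ x := fun c hc h => hxN (h ▸ hc)
  have : ∀ z, ∃ y, z ∈ N → y ∈ N ∧ (z < x → z < y ∧ y < x) ∧ (x < z → x < y ∧ y < z) := by
    intro z
    by_cases hz : z ∈ N
    · have h := hno' z hz
      simp only [IsNeighbour, not_or, not_and, not_forall, not_lt] at h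
      rcases (hne z hz).lt_or_gt with hzx | hxz
      · obtain ⟨y, hy, h1, h2⟩ := h.1 hzx
        exact ⟨y, fun _ => ⟨hy, fun _ => ⟨h1, lt_of_le_of_ne h2 (hne y hy)⟩,
          fun h' => (hzx.asymm h').elim⟩⟩
      · obtain ⟨y, hy, h1, h2⟩ := h.2 hxz
        exact ⟨y, fun _ => ⟨hy, fun h' => (hxz.asymm h').elim,
          fun _ => ⟨lt_of_le_of_ne h2 (hne y hy).symm, h1⟩⟩⟩
    · exact ⟨z, fun h => (hz h).elim⟩
  choose g hg using this
  let Θ : Finset K → Set K := fun s => Ψ s ∪ g '' s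
  have hΘ : ∀ s, (Θ s).Countable := fun s => (hΨ s).union (s.countable_toSet.image g)
  have hNΘ : ClosedUnder Θ N := fun s hs => union_subset (hN s hs) (by
    rintro _ ⟨z, hz, rfl⟩
    exact (hg z (hs hz)).1)
  -- Gap-freeness concerns countable sets only, so `N` is replaced by a countable subset closed
  -- under `g`, which moves its elements closer to `x`.
  let M := opClosure Θ ∅
  have hMcl : ClosedUnder Θ M := closedUnder_opClosure ∅
  have hMN : M ⊆ N := opClosure_subset hNΘ (empty_subset _)
  have hMc : M.Countable := countable_opClosure hΘ countable_empty
  have hEM : E ⊆ M := (subset_union_left.trans subset_union_right).trans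
    (subset_union_left.trans (hMcl ∅ (by simp)))
  have hgM : ∀ z ∈ M, g z ∈ M := fun z hz =>
    hMcl {z} (by simpa using hz) (Or.inr ⟨z, by simp, rfl⟩)
  obtain ⟨a, b, hab⟩ := exists_isGap (N := M) (x := x) (fun h => hxN (hMN h))
    ((hEb x).1.imp fun m h => ⟨hEM h.1, h.2⟩) ((hEb x).2.imp fun m h => ⟨hEM h.1, h.2⟩)
    (fun c hc hcx => ⟨g c, hgM c hc, (hg c (hMN hc)).2.1 hcx⟩)
    (fun c hc hcx => ⟨g c, hgM c hc, (hg c (hMN hc)).2.2 hcx⟩)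
    fun h => hxA ⟨M, hMc, h⟩
  exact hgap M hMc (hMcl.of_le fun s => subset_union_left.trans subset_union_left) a b hab

end Compact

/-! ### Ordinal ranks from fragmentation -/

section Rank

variable {X : Type u}

/-- The transfinite sequence of the sets obtained by applying `U` to the union of the previous
ones. -/
noncomputable def layers (U : Set X → Set X) (α : Ordinal.{u}) : Set X :=
  U (⋃ β : Iio α, layers U β.1)
termination_by α
decreasing_by exact β.2

/-- A fragmented space has, for every `ε > 0`, an upper semicontinuous ordinal rank whose level
sets have diameter less than `ε`. -/
theorem Fragments.exists_rank [TopologicalSpace X] {d : X → X → ℝ} (hd : Fragments d) {ε : ℝ}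
    (hε : 0 < ε) : ∃ ρ : X → Ordinal.{u}, (∀ α, IsClosed {x | α ≤ ρ x}) ∧
      ∀ x y, ρ x = ρ y → d x y < ε := by
  have : ∀ A : Set X, ∃ U : Set X, IsOpen U ∧ (A ≠ univ → (U ∩ Aᶜ).Nonempty) ∧
      ∀ x ∈ U ∩ Aᶜ, ∀ y ∈ U ∩ Aᶜ, d x y < ε := by
    intro A
    by_cases hA : A = univ
    · exact ⟨∅, isOpen_empty, fun h => (h hA).elim, fun x hx => hx.1.elim⟩
    · obtain ⟨U, hU, hne, δ, hδ, h⟩ := hd Aᶜ (nonempty_compl.2 hA) ε hε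
      exact ⟨U, hU, fun _ => hne, fun x hx y hy => (h x hx y hy).trans_lt hδ⟩
  choose U hU hne hdiam using this
  let V := layers U
  have hV : ∀ α, V α = U (⋃ β : Iio α, V β) := fun α => by
    change layers U α = _
    rw [layers]
  have hVopen : ∀ α, IsOpen (V α) := fun α => hV α ▸ hU _
  -- Otherwise each stage would take in a new point, injecting all ordinals into `X`.
  have hcover : ∀ x, ∃ α, x ∈ V α := by
    by_contra! h
    obtain ⟨x, hx⟩ := h
    have : ∀ α, ∃ p, p ∈ V α ∧ ∀ β < α, p ∉ V β := by
      intro α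
      obtain ⟨p, hp, hp'⟩ := hne (⋃ β : Iio α, V β) fun h => by
        obtain ⟨β, hβ⟩ := mem_iUnion.1 (h ▸ mem_univ x)
        exact hx _ hβ
      exact ⟨p, (hV α).symm ▸ hp, fun β hβ hpβ => hp' (mem_iUnion.2 ⟨⟨β, hβ⟩, hpβ⟩)⟩
    choose p hp hp' using this
    refine not_injective_of_ordinal p fun α β hαβ => ?_
    by_contra hne
    rcases lt_or_gt_of_ne hne with h | h
    · exact hp' β α h (hαβ ▸ hp α)
    · exact hp' α β h (hαβ ▸ hp β)
  let ρ : X → Ordinal.{u} := fun x => sInf {α | x ∈ V α}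
  have hρ : ∀ x, x ∈ V (ρ x) := fun x => csInf_mem (s := {α | x ∈ V α}) (hcover x)
  have hρ' : ∀ x, ∀ β < ρ x, x ∉ V β := fun x β hβ h => notMem_of_lt_csInf' hβ h
  refine ⟨ρ, fun α => ?_, fun x y hxy => ?_⟩
  · have : {x | α ≤ ρ x} = ⋂ β : Iio α, (V β)ᶜ := by
      ext x
      simp only [mem_iInter, mem_compl_iff, Subtype.forall]
      refine ⟨fun h β hβ => hρ' x β (lt_of_lt_of_le hβ h), fun h => ?_⟩
      change α ≤ ρ x
      by_contra! hlt
      exact h _ hlt (hρ x)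
    rw [this]
    exact isClosed_iInter fun β => (hVopen β).isClosed_compl
  · have hmem : ∀ z, ρ z = ρ x → z ∈ U (⋃ β : Iio (ρ x), V β) ∩ (⋃ β : Iio (ρ x), V β)ᶜ := by
      intro z hz
      rw [← hz]
      refine ⟨hV (ρ z) ▸ hρ z, fun h => ?_⟩
      obtain ⟨β, hβ⟩ := mem_iUnion.1 h
      exact hρ' z β β.2 hβ
    exact hdiam _ x (hmem x rfl) y (hmem y hxy.symm)

end Rank

/-! ### Fragmentable compact lines are gap-free -/

section GapFree

variable {K : Type u} [LinearOrder K] [TopologicalSpace K] [OrderTopology K]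

/-- The set of the points of `Icc c e` with the largest value of `ρ`. -/
def maxSet (ρ : K → Ordinal.{u}) (c e : K) : Set K :=
  {x ∈ Icc c e | ∀ y ∈ Icc c e, ρ y ≤ ρ x}

theorem exists_isLeast_isGreatest_maxSet [CompactSpace K] {ρ : K → Ordinal.{u}}
    (hρ : ∀ α, IsClosed {x | α ≤ ρ x}) {c e : K} (h : c ≤ e) :
    (∃ p, IsLeast (maxSet ρ c e) p) ∧ ∃ q, IsGreatest (maxSet ρ c e) q := by
  obtain ⟨a, ha, hmax⟩ := UpperSemicontinuousOn.exists_isMaxOn (nonempty_Icc.2 h)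
    (isClosed_Icc (a := c) (b := e)).isCompact (f := ρ) fun x _ α hα => by
      refine nhdsWithin_le_nhds ?_
      have := (hρ α).isOpen_compl.mem_nhds (x := x) hα.not_ge
      filter_upwards [this] with y hy
      exact not_le.1 hy
  have hcl : IsClosed (maxSet ρ c e) := by
    have : maxSet ρ c e = Icc c e ∩ {x | ρ a ≤ ρ x} := by
      ext x
      exact ⟨fun hx => ⟨hx.1, hx.2 a ha⟩, fun hx => ⟨hx.1, fun y hy => (hmax hy).trans hx.2⟩⟩
    rw [this]
    exact isClosed_Icc.inter (hρ _)
  have hne : (maxSet ρ c e).Nonempty := ⟨a, ha, fun y hy => hmax hy⟩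
  exact ⟨hcl.isCompact.exists_isLeast hne, hcl.isCompact.exists_isGreatest hne⟩

/-- An upper semicontinuous ordinal rank takes the same value at the end points of a gap of `N`, if
`N` contains the extremal points of maximal rank of the intervals with end points in `N`. -/
theorem IsGap.rank_eq {ρ : K → Ordinal.{u}} (hρ : ∀ α, IsClosed {x | α ≤ ρ x}) {N : Set K}
    {p q : K → K → K} (hp : ∀ c e, c ≤ e → IsLeast (maxSet ρ c e) (p c e))
    (hq : ∀ c e, c ≤ e → IsGreatest (maxSet ρ c e) (q c e))
    (hpN : ∀ c ∈ N, ∀ e ∈ N, p c e ∈ N) (hqN : ∀ c ∈ N, ∀ e ∈ N, q c e ∈ N) {a b : K}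
    (hab : IsGap N a b) (ha : ∃ c ∈ N, c < a) (hb : ∃ e ∈ N, b < e) : ρ a = ρ b := by
  obtain ⟨hlt, hmiss, hl, hr⟩ := hab
  let P : Set (K × K) := {w | w.1 ∈ N ∧ w.1 < a ∧ w.2 ∈ N ∧ b < w.2}
  let m : K × K → Ordinal.{u} := fun w => ρ (p w.1 w.2)
  have hP : P.Nonempty := by
    obtain ⟨c, hc⟩ := ha
    obtain ⟨e, he⟩ := hb
    exact ⟨(c, e), hc.1, hc.2, he.1, he.2⟩
  -- Choose an interval around the gap with ends in `N` whose maximal rank `μ` is least. Shrinking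
  -- it towards the gap leaves the maximum unchanged.
  obtain ⟨⟨c₀, e₀⟩, ⟨hc₀, hca₀, he₀, hbe₀⟩, hmin⟩ : ∃ w, w ∈ P ∧ ∀ w' ∈ P, m w ≤ m w' :=
    ⟨Function.argminOn m P hP, Function.argminOn_mem m P hP,
      fun w' hw' => Function.argminOn_le m P hw'⟩
  set μ := m (c₀, e₀) with hμ
  have hle : ∀ x ∈ Icc c₀ e₀, ρ x ≤ μ := fun x hx => (hp c₀ e₀ (hx.1.trans hx.2)).1.2 x hx
  have hpq : ∀ c ∈ N, c < a → c₀ ≤ c → ∀ e ∈ N, b < e → e ≤ e₀ →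
      ρ (p c e) = μ ∧ ρ (q c e) = μ := by
    intro c hc hca hcc e he hbe hee
    have hce : c ≤ e := (hca.trans (hlt.trans hbe)).le
    have h1 := (hp c e hce).1
    have h2 := (hq c e hce).1
    have h3 : ρ (p c e) = μ := le_antisymm (hle _ ⟨hcc.trans h1.1.1, h1.1.2.trans hee⟩)
      (hmin (c, e) ⟨hc, hca, he, hbe⟩)
    exact ⟨h3, (le_antisymm (h1.2 _ h2.1) (h2.2 _ h1.1)).trans h3⟩
  have hae : a < e₀ := hlt.trans hbe₀
  have hcb : c₀ < b := hca₀.trans hlt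
  trans μ
  · refine le_antisymm (hle _ ⟨hca₀.le, hae.le⟩) ?_
    -- If `ρ a < μ`, ranks stay below `μ` on some `[c, a]` with `c ∈ N`. The first maximal point of
    -- `[c, e₀]` lies in `N`, hence beyond `b`; an `e ∈ N` between `b` and it gives an interval `[c,
    -- e]` with an earlier point of rank `μ`.
    by_contra! hlow
    obtain ⟨l, hla, hsub⟩ := exists_Ioc_subset_of_mem_nhds'
      ((hρ μ).isOpen_compl.mem_nhds (x := a) hlow.not_ge) hca₀
    obtain ⟨c, hc, hlc, hca⟩ := hl l hla.2
    have hcc : c₀ ≤ c := hla.1.trans hlc.le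
    have hP1 := hp c e₀ (hca.trans hae).le
    rcases hmiss _ (hpN c hc e₀ he₀) with hpa | hbp
    · exact hsub ⟨hlc.trans_le hP1.1.1.1, hpa.le⟩ (hpq c hc hca hcc e₀ he₀ hbe₀ le_rfl).1.ge
    · obtain ⟨e, he, hbe, hep⟩ := hr _ hbp
      have hee : e ≤ e₀ := hep.le.trans hP1.1.1.2
      have h1 := (hp c e (hca.trans (hlt.trans hbe)).le).1.1
      have h2 := (hpq c hc hca hcc e he hbe hee).1
      have hmem : p c e ∈ maxSet ρ c e₀ := ⟨⟨h1.1, h1.2.trans hee⟩, fun y hy => by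
        rw [h2]
        exact hle y ⟨hcc.trans hy.1, hy.2⟩⟩
      exact (hP1.2 hmem).not_gt (h1.2.trans_lt hep)
  · refine (le_antisymm (hle _ ⟨hcb.le, hbe₀.le⟩) ?_).symm
    by_contra! hlow
    obtain ⟨l, hbl, hsub⟩ := exists_Ico_subset_of_mem_nhds'
      ((hρ μ).isOpen_compl.mem_nhds (x := b) hlow.not_ge) hbe₀
    obtain ⟨e, he, hbe, hel⟩ := hr l hbl.1
    have hee : e ≤ e₀ := hel.le.trans hbl.2
    have hQ1 := hq c₀ e (hcb.trans hbe).le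
    rcases hmiss _ (hqN c₀ hc₀ e he) with hqa | hbq
    · obtain ⟨c, hc, hqc, hca⟩ := hl _ hqa
      have hcc : c₀ ≤ c := hQ1.1.1.1.trans hqc.le
      have h1 := (hq c e (hca.trans (hlt.trans hbe)).le).1.1
      have h2 := (hpq c hc hca hcc e he hbe hee).2
      have hmem : q c e ∈ maxSet ρ c₀ e := ⟨⟨hcc.trans h1.1, h1.2⟩, fun y hy => by
        rw [h2]
        exact hle y ⟨hy.1, hy.2.trans hee⟩⟩
      exact (hQ1.2 hmem).not_gt (hqc.trans_le h1.1)
    · exact hsub ⟨hbq.le, hQ1.1.1.2.trans_lt hel⟩ (hpq c₀ hc₀ hca₀ le_rfl e he hbe hee).2.ge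

/-- Close under the first and last points of maximal rank for the ranks belonging to `ε = 1 / (n +
1)`. The ends of a gap then have distance below every `ε`. -/
theorem IsFragmentable.isGapFree [CompactSpace K] (h : IsFragmentable K) : IsGapFree K := by
  obtain ⟨d, hd, hfr⟩ := h
  obtain ⟨E, hE, hEb⟩ := exists_countable_bounds K
  choose ρ hρ hρd using fun n : ℕ => hfr.exists_rank (Nat.one_div_pos_of_nat (α := ℝ) (n := n))
  have hex : ∀ (n : ℕ) (c e : K), ∃ p q, c ≤ e →
      IsLeast (maxSet (ρ n) c e) p ∧ IsGreatest (maxSet (ρ n) c e) q := fun n c e => by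
    by_cases hce : c ≤ e
    · obtain ⟨⟨p, hp⟩, q, hq⟩ := exists_isLeast_isGreatest_maxSet (hρ n) hce
      exact ⟨p, q, fun _ => ⟨hp, hq⟩⟩
    · exact ⟨c, c, fun h => (hce h).elim⟩
  choose p q hpq using hex
  refine ⟨fun s => E ∪ ⋃ n, (image2 (p n) s s ∪ image2 (q n) s s), fun s => hE.union
    (countable_iUnion fun n => (s.countable_toSet.image2 s.countable_toSet _).union
      (s.countable_toSet.image2 s.countable_toSet _)), fun N hNc hN a b hab => ?_⟩
  have hEN : E ⊆ N := subset_union_left.trans (hN ∅ (by simp))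
  have hpair : ∀ n, ∀ c ∈ N, ∀ e ∈ N, p n c e ∈ N ∧ q n c e ∈ N := by
    classical
    intro n c hc e he
    have := hN {c, e} (by simp [insert_subset_iff, hc, he])
    exact ⟨this (Or.inr (mem_iUnion.2 ⟨n, Or.inl (mem_image2_of_mem (by simp) (by simp))⟩)),
      this (Or.inr (mem_iUnion.2 ⟨n, Or.inr (mem_image2_of_mem (by simp) (by simp))⟩))⟩
  have ha : ∃ c ∈ N, c < a := by
    obtain ⟨c, hc, hca⟩ := (hEb a).1
    exact ⟨c, hEN hc, (hab.2.1 c (hEN hc)).resolve_right (hca.trans hab.1.le).not_gt⟩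
  have hb : ∃ e ∈ N, b < e := by
    obtain ⟨e, he, hbe⟩ := (hEb b).2
    exact ⟨e, hEN he, (hab.2.1 e (hEN he)).resolve_left (hab.1.le.trans hbe).not_gt⟩
  have hsmall : ∀ n : ℕ, d a b < 1 / ((n : ℝ) + 1) := fun n =>
    hρd n a b (hab.rank_eq (hρ n) (fun c e h => (hpq n c e h).1) (fun c e h => (hpq n c e h).2)
      (fun c hc e he => (hpair n c hc e he).1) (fun c hc e he => (hpair n c hc e he).2) ha hb)
  have h0 : 0 < d a b := lt_of_le_of_ne (hd.nonneg a b) fun h =>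
    hab.1.ne ((hd.eq_zero_iff a b).1 h.symm)
  obtain ⟨n, hn⟩ := exists_nat_one_div_lt h0
  exact hn.not_gt (hsmall n)

end GapFree

/-! ### Separation by jumps -/

section Separation

variable {K : Type u} [LinearOrder K]

/-- Some jump whose left end point is in `S` lies between `x` and `y`. -/
def SplitBy (S : Set K) (x y : K) : Prop :=
  ∃ a b, a ⋖ b ∧ a ∈ S ∧ ((x ≤ a ∧ b ≤ y) ∨ (y ≤ a ∧ b ≤ x))

theorem not_splitBy_self (S : Set K) (x : K) : ¬ SplitBy S x x := by
  rintro ⟨a, b, hab, -, h | h⟩ <;> exact (h.1.trans_lt hab.lt).not_ge h.2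

theorem SplitBy.symm {S : Set K} {x y : K} : SplitBy S x y → SplitBy S y x :=
  fun ⟨a, b, hab, ha, h⟩ => ⟨a, b, hab, ha, h.symm⟩

/-- No point lies strictly inside a jump, so `y` is on one side of it. This is the source of the
triangle inequality. -/
theorem SplitBy.or {S : Set K} {x z : K} (h : SplitBy S x z) (y : K) :
    SplitBy S x y ∨ SplitBy S y z := by
  obtain ⟨a, b, hab, ha, h⟩ := h
  rcases le_or_gt y a with hy | hy
  · rcases h with h | h
    · exact Or.inr ⟨a, b, hab, ha, Or.inl ⟨hy, h.2⟩⟩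
    · exact Or.inl ⟨a, b, hab, ha, Or.inr ⟨hy, h.2⟩⟩
  · have hy := hab.ge_of_gt hy
    rcases h with h | h
    · exact Or.inl ⟨a, b, hab, ha, Or.inl ⟨h.1, hy⟩⟩
    · exact Or.inr ⟨a, b, hab, ha, Or.inr ⟨h.1, hy⟩⟩

variable [TopologicalSpace K] [OrderTopology K]

theorem isOpen_Iic_of_covBy {a b : K} (h : a ⋖ b) : IsOpen (Iic a) := by
  rw [← h.Iio_eq]
  exact isOpen_Iio

theorem isOpen_Ici_of_covBy {a b : K} (h : a ⋖ b) : IsOpen (Ici b) := by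
  rw [← h.Ioi_eq]
  exact isOpen_Ioi

theorem SplitBy.eventually {S : Set K} {w : K × K} (h : SplitBy S w.1 w.2) :
    ∀ᶠ w' in nhds w, SplitBy S w'.1 w'.2 := by
  obtain ⟨a, b, hab, ha, h⟩ := h
  rcases h with h | h
  · filter_upwards [((isOpen_Iic_of_covBy hab).prod (isOpen_Ici_of_covBy hab)).mem_nhds
      (mk_mem_prod h.1 h.2)] with w' hw'
    exact ⟨a, b, hab, ha, Or.inl hw'⟩
  · filter_upwards [((isOpen_Ici_of_covBy hab).prod (isOpen_Iic_of_covBy hab)).mem_nhds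
      (mk_mem_prod h.2 h.1)] with w' hw'
    exact ⟨a, b, hab, ha, Or.inr hw'.symm⟩

/-- Otherwise every convex open set meeting `Y` is cut by a jump from `S` into two such sets, and
iteration builds a copy of `ℚ` in `S`. -/
theorem ScatteredIn.exists_not_splitBy {S : Set K} (hS : ScatteredIn S) {Y : Set K}
    (hY : Y.Nonempty) : ∃ U : Set K, IsOpen U ∧ (U ∩ Y).Nonempty ∧
      ∀ x ∈ U ∩ Y, ∀ y ∈ U ∩ Y, ¬ SplitBy S x y := by
  by_contra! hcon
  let ι := {U : Set K // IsOpen U ∧ (U ∩ Y).Nonempty ∧ U.OrdConnected}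
  have : ∀ U : ι, ∃ a b, a ⋖ b ∧ a ∈ S ∧
      ∃ x ∈ U.1 ∩ Y, ∃ y ∈ U.1 ∩ Y, x ≤ a ∧ b ≤ y := by
    rintro ⟨U, hU, hne, -⟩
    obtain ⟨x, hx, y, hy, a, b, hab, ha, h | h⟩ := hcon U hU hne
    · exact ⟨a, b, hab, ha, x, hx, y, hy, h⟩
    · exact ⟨a, b, hab, ha, y, hy, x, hx, h⟩
  choose a b hab haS x hx y hy hxa hby using this
  have haU : ∀ U : ι, a U ∈ U.1 := fun U =>
    U.2.2.2.out (hx U).1 (hy U).1 ⟨hxa U, (hab U).le.trans (hby U)⟩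
  let l : ι → ι := fun U => ⟨U.1 ∩ Iic (a U), U.2.1.inter (isOpen_Iic_of_covBy (hab U)),
    ⟨x U, ⟨(hx U).1, hxa U⟩, (hx U).2⟩, U.2.2.2.inter ordConnected_Iic⟩
  let r : ι → ι := fun U => ⟨U.1 ∩ Ici (b U), U.2.1.inter (isOpen_Ici_of_covBy (hab U)),
    ⟨y U, ⟨(hy U).1, hby U⟩, (hy U).2⟩, U.2.2.2.inter ordConnected_Ici⟩
  -- The left half contains the cut point `a U` as its maximum; discarding maxima puts it strictly
  -- below `a U`.
  refine not_scatteredIn_of_splitting (fun U : ι => {v ∈ U.1 | ∃ w ∈ U.1, v < w}) a l r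
    ⟨univ, isOpen_univ, by simpa using hY, ordConnected_univ⟩ haS ?_ ?_ ?_ hS
  · exact fun U => ⟨haU U, y U, (hy U).1, (hab U).lt.trans_le (hby U)⟩
  · rintro U v ⟨hv, w, hw, hvw⟩
    exact ⟨⟨hv.1, w, hw.1, hvw⟩, hvw.trans_le hw.2⟩
  · rintro U v ⟨hv, w, hw, hvw⟩
    exact ⟨⟨hv.1, w, hw.1, hvw⟩, (hab U).lt.trans_le hv.2⟩

theorem exists_forall_lt_not_splitBy {S : ℕ → Set K} (hS : ∀ n, ScatteredIn (S n)) {Y : Set K}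
    (hY : Y.Nonempty) (n : ℕ) : ∃ U : Set K, IsOpen U ∧ (U ∩ Y).Nonempty ∧
      ∀ k < n, ∀ x ∈ U ∩ Y, ∀ y ∈ U ∩ Y, ¬ SplitBy (S k) x y := by
  induction n with
  | zero => exact ⟨univ, isOpen_univ, by simpa using hY, fun k hk => (Nat.not_lt_zero k hk).elim⟩
  | succ n ih =>
    obtain ⟨U, hU, hne, h⟩ := ih
    obtain ⟨V, hV, hne', h'⟩ := (hS n).exists_not_splitBy hne
    refine ⟨V ∩ U, hV.inter hU, by rwa [inter_assoc], fun k hk x hx y hy => ?_⟩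
    rcases Nat.lt_succ_iff_lt_or_eq.1 hk with hk | rfl
    · exact h k hk x ⟨hx.1.2, hx.2⟩ y ⟨hy.1.2, hy.2⟩
    · exact h' x ⟨hx.1.1, hx.1.2, hx.2⟩ y ⟨hy.1.1, hy.1.2, hy.2⟩

end Separation

/-! ### The metric defined by jumps -/

section Separation

variable {K : Type u} [LinearOrder K]

open Classical in
/-- The weight `2⁻ⁿ` if `S n` splits the pair `x`, `y`, and `0` otherwise. -/
noncomputable def splitTerm (S : ℕ → Set K) (x y : K) (n : ℕ) : ℝ :=
  if SplitBy (S n) x y then (1 / 2) ^ n else 0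

/-- The sum of the weights `2⁻ⁿ` over the `n` for which `S n` splits the pair `x`, `y`. -/
noncomputable def splitDist (S : ℕ → Set K) (x y : K) : ℝ :=
  ∑' n, splitTerm S x y n

theorem splitTerm_nonneg (S : ℕ → Set K) (x y : K) (n : ℕ) : 0 ≤ splitTerm S x y n := by
  unfold splitTerm
  split_ifs <;> positivity

theorem splitTerm_le (S : ℕ → Set K) (x y : K) (n : ℕ) : splitTerm S x y n ≤ (1 / 2) ^ n := by
  unfold splitTerm
  split_ifs
  · exact le_rfl
  · positivity

theorem summable_splitTerm (S : ℕ → Set K) (x y : K) : Summable (splitTerm S x y) :=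
  .of_nonneg_of_le (splitTerm_nonneg S x y) (splitTerm_le S x y) summable_geometric_two

theorem isMetric_splitDist {S : ℕ → Set K} (hsep : ∀ x y, x < y → ∃ n, SplitBy (S n) x y) :
    IsMetric (splitDist S) where
  nonneg x y := tsum_nonneg (splitTerm_nonneg S x y)
  eq_zero_iff x y := by
    constructor
    · intro h
      by_contra hne
      have : ∃ n, SplitBy (S n) x y := by
        rcases lt_or_gt_of_ne hne with h | h
        · exact hsep x y h
        · exact (hsep y x h).imp fun _ h => h.symm
      obtain ⟨n, hn⟩ := this
      have h1 := (summable_splitTerm S x y).le_tsum n fun m _ => splitTerm_nonneg S x y m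
      have h2 : (0 : ℝ) < splitTerm S x y n := by
        rw [splitTerm, if_pos hn]
        positivity
      exact (h2.trans_le h1).ne' h
    · rintro rfl
      simp [splitDist, splitTerm, not_splitBy_self]
  symm x y := by
    unfold splitDist splitTerm
    congr 1
    ext n
    have : SplitBy (S n) x y ↔ SplitBy (S n) y x := ⟨.symm, .symm⟩
    split_ifs <;> tauto
  triangle x y z := by
    unfold splitDist
    rw [← (summable_splitTerm S x y).tsum_add (summable_splitTerm S y z)]
    refine (summable_splitTerm S x z).tsum_le_tsum (fun n => ?_)
      ((summable_splitTerm S x y).add (summable_splitTerm S y z))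
    have h1 := splitTerm_nonneg S x y n
    have h2 := splitTerm_nonneg S y z n
    by_cases h : SplitBy (S n) x z
    · have h3 := splitTerm_le S x z n
      rcases h.or y with h | h
      · have : splitTerm S x y n = (1 / 2) ^ n := if_pos h
        linarith
      · have : splitTerm S y z n = (1 / 2) ^ n := if_pos h
        linarith
    · have : splitTerm S x z n = 0 := if_neg h
      linarith

end Separation

/-! ### Lower semicontinuity and fragmentation of the metric -/

section Separation

variable {K : Type u} [LinearOrder K] [TopologicalSpace K] [OrderTopology K]

/-- Being split is an open condition, so near `w` the terms of a finite partial sum exceeding `r` do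
not decrease. -/
theorem lowerSemicontinuous_splitDist (S : ℕ → Set K) :
    LowerSemicontinuous fun w : K × K => splitDist S w.1 w.2 := by
  intro w r hr
  obtain ⟨s, hs⟩ := ((summable_splitTerm S w.1 w.2).hasSum.eventually_const_lt hr).exists
  have : ∀ᶠ w' in nhds w, ∀ n ∈ s, splitTerm S w.1 w.2 n ≤ splitTerm S w'.1 w'.2 n := by
    refine (Filter.eventually_all_finset s).2 fun n _ => ?_
    by_cases h : SplitBy (S n) w.1 w.2
    · filter_upwards [h.eventually] with w' hw'
      rw [splitTerm, splitTerm, if_pos h, if_pos hw']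
    · refine Filter.Eventually.of_forall fun w' => ?_
      rw [splitTerm, if_neg h]
      exact splitTerm_nonneg _ _ _ _
  filter_upwards [this] with w' hw'
  exact hs.trans_le ((Finset.sum_le_sum hw').trans
    ((summable_splitTerm S w'.1 w'.2).sum_le_tsum s fun n _ => splitTerm_nonneg _ _ _ n))

theorem fragments_splitDist {S : ℕ → Set K} (hS : ∀ n, ScatteredIn (S n)) :
    Fragments (splitDist S) := by
  intro Y hY ε hε
  obtain ⟨n, hn⟩ := exists_pow_lt_of_lt_one (half_pos hε) (one_half_lt_one (α := ℝ))
  obtain ⟨U, hU, hne, h⟩ := exists_forall_lt_not_splitBy hS hY n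
  -- The first `n` terms vanish on `U ∩ Y`, and the geometric tail sums to at most `2 · 2⁻ⁿ < ε`.
  refine ⟨U, hU, hne, (1 / 2) ^ n * 2, by linarith, fun x hx y hy => ?_⟩
  rw [splitDist, ← (summable_splitTerm S x y).sum_add_tsum_nat_add n,
    Finset.sum_eq_zero (f := splitTerm S x y)
      fun k hk => if_neg (h k (Finset.mem_range.1 hk) x hx y hy), zero_add]
  have hg : ∑' k, (1 / 2 : ℝ) ^ n * (1 / 2) ^ k = (1 / 2) ^ n * 2 := by
    rw [tsum_mul_left, tsum_geometric_two]
  rw [← hg]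
  refine Summable.tsum_le_tsum (fun k => ?_)
    ((summable_nat_add_iff n).2 (summable_splitTerm S x y)) (summable_geometric_two.mul_left _)
  rw [← pow_add, add_comm n]
  exact splitTerm_le _ _ _ _

theorem isRadonNikodymCompact_of_sigmaScatteredIn [CompactSpace K] (hK : IsZeroDimensional K)
    (h : SigmaScatteredIn (isolatedPts K)) : IsRadonNikodymCompact K := by
  obtain ⟨S, hLS, hS⟩ := h
  refine ⟨splitDist S, isMetric_splitDist fun x y hxy => ?_, lowerSemicontinuous_splitDist S,
    fragments_splitDist hS⟩
  obtain ⟨a, b, hxa, hab, hby⟩ := exists_covBy_between hK hxy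
  obtain ⟨n, hn⟩ := mem_iUnion.1 (hLS (left_mem_isolatedPts hab))
  exact ⟨n, a, b, hab, hn, Or.inl ⟨hxa, hby⟩⟩

end Separation

end CompactLine

theorem theorem3p1 (K : Type u) [LinearOrder K] [TopologicalSpace K] [OrderTopology K]
    [CompactSpace K] (hK : CompactLine.IsZeroDimensional K) :
    List.TFAE
      [CompactLine.IsFragmentable K,
        ¬ CompactLine.IsStationaryFamily (CompactLine.nonCapturing K),
        CompactLine.IsSigmaScattered (CompactLine.isolatedPts K),
        CompactLine.IsRadonNikodymCompact K] := by
  tfae_have 1 → 2 := fun h => h.isGapFree.not_isStationaryFamily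
  tfae_have 2 → 3 := fun h => (CompactLine.isSigmaScattered_iff _).2
    (CompactLine.isGapFree_of_not_isStationaryFamily hK h).sigmaScatteredIn
  tfae_have 3 → 4 := fun h => CompactLine.isRadonNikodymCompact_of_sigmaScatteredIn hK
    ((CompactLine.isSigmaScattered_iff _).1 h)
  tfae_have 4 → 1 := fun ⟨d, hd, _, hfr⟩ => ⟨d, hd, hfr⟩
  tfae_finish
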